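/- Write $S=\begin{pmatrix}0&-1\\1&0\end{pmatrix}$, $T=\begin{pmatrix}1&1\\0&1\end{pmatrix}$, $U=\begin{pmatrix}1&-1\\1&0\end{pmatrix}$. Let $\tilde{\mathcal M}$ be the torsion-free abelian group generated by symbols $\{g,g'\}$, $(g,g')\in \mathrm{SL}_2(\mathbf Z)^2$, with the relations $\{g,g'\}+\{g',g''\}+\{g'',g\}=0$; $\{g,g'\}=\{\epsilon_1 g,\epsilon_2 g'\}$ for $\epsilon_1,\epsilon_2\in\{\pm1\}$; and $\{g,gT^n\}=n\{g,gT\}$ for $n\in\mathbf Z$. The group $\mathrm{SL}_2(\mathbf Z)$ acts on it by $\gamma\cdot\{g,g'\}=\{\gamma g,\gamma g'\}$. For a finite index subgroup $\Gamma$ of $\mathrm{SL}_2(\mathbf Z)$, let $\tilde{\mathcal M}_\Gamma$ be the largest torsion-free quotient of $\tilde{\mathcal M}$ on which $\Gamma$ acts trivially, and let $$\tilde\xi_\Gamma:\mathbf Z[\Gamma\backslash\mathrm{PSL}_2(\mathbf Z)]\to\tilde{\mathcal M}_\Gamma,\qquad \Gamma g\mapsto\{g,gS\}$$ be the Manin map.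 Let $\mathcal C_\Gamma=\Gamma\backslash\mathbf P^1(\mathbf Q)$ be the (finite) set of cusps, $e_c$ the width of $c\in\mathcal C_\Gamma$ (for $c=\Gamma g\infty$, the least $h>0$ with $\pm gT^hg^{-1}\in\Gamma$, i.e. the ramification index of $X_\Gamma\to X_{\mathrm{SL}_2(\mathbf Z)}$ at $c$), $d_\Gamma=\gcd_c(e_c)$, and let $\mathbf Z[\mathcal C_\Gamma]_0$ be the quotient of $\mathbf Z[\mathcal C_\Gamma]$ by the subgroup generated by $\frac1{d_\Gamma}\sum_{c}e_c[c]$; write $(c)$ for the image of $[c]$ there. Let $\varphi_\Gamma:\mathbf Z[\Gamma\backslash\mathrm{PSL}_2(\mathbf Z)]\to\mathbf Z[\mathcal C_\Gamma]_0$ be given by $\Gamma g\mapsto(\Gamma g\infty)$. For $h\in\mathrm{SL}_2(\mathbf Z)$, let $\mathbf Z[\Gamma\backslash\mathrm{PSL}_2(\mathbf Z)]^h$ be the subgroup of elements fixed by right multiplication by $h$. 1. For every finite index subgroup $\Gamma$ of $\mathrm{SL}_2(\mathbf Z)$, the cokernel of $\tilde\xi_\Gamma$ is canonically isomorphic to the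 cokernel of the restriction of $\varphi_\Gamma$ to $\mathbf Z[\Gamma\backslash\mathrm{PSL}_2(\mathbf Z)]^U$: there is an isomorphism $$\mathbf Z[\mathcal C_\Gamma]_0/\varphi_\Gamma\bigl(\mathbf Z[\Gamma\backslash\mathrm{PSL}_2(\mathbf Z)]^U\bigr)\xrightarrow{\ \sim\ }\tilde{\mathcal M}_\Gamma/\mathrm{Im}(\tilde\xi_\Gamma)$$ sending the class of $(\Gamma g\infty)$ to the class of $\{g,gT\}$ for every $g\in\mathrm{SL}_2(\mathbf Z)$. 2. Let $p\ge5$ be a prime and $n\ge1$ an integer. If $\Gamma=\Gamma_1(p^n)$ or $\Gamma=\Gamma_0(p^n)$, then the image of $\tilde\xi_\Gamma$ has finite index in $\tilde{\mathcal M}_\Gamma$, this index divides $3$, and it equals $1$ if and only if $p\equiv1\pmod 3$ and $\Gamma=\Gamma_0(p^n)$. 3. For every finite index subgroup $\Gamma$ of $\mathrm{SL}_2(\mathbf Z)$, the kernel of $\tilde\xi_\Gamma$ is the sum of the subgroups $\mathbf Z[\Gamma\backslash\mathrm{PSL}_2(\mathbf Z)]^S$ and $\mathrm{Ker}(\varphi_\Gamma)\cap\mathbf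 Z[\Gamma\backslash\mathrm{PSL}_2(\mathbf Z)]^U$. -/

import Mathlib

open scoped MatrixGroups
open ModularGroup

namespace MixedModularSymbols

/-! ### Largest torsion-free quotients -/

/-- The saturation of a subgroup `H` of an abelian group `A`: the elements having a nonzero multiple
in `H`.  The quotient of `A` by it is the largest torsion-free quotient of `A ⧸ H`. -/
def saturation {A : Type*} [AddCommGroup A] (H : AddSubgroup A) : AddSubgroup A where
  carrier := {a | ∃ n : ℕ, n ≠ 0 ∧ n • a ∈ H}
  zero_mem' := ⟨1, one_ne_zero, by simp⟩
  add_mem' := by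
    rintro a b ⟨m, hm, ha⟩ ⟨n, hn, hb⟩
    refine ⟨m * n, mul_ne_zero hm hn, ?_⟩
    rw [smul_add]
    refine H.add_mem ?_ ?_
    · rw [mul_comm, mul_smul]
      exact H.nsmul_mem ha n
    · rw [mul_smul]
      exact H.nsmul_mem hb m
  neg_mem' := by
    rintro a ⟨n, hn, ha⟩
    exact ⟨n, hn, by rw [smul_neg]; exact H.neg_mem ha⟩

theorem le_saturation {A : Type*} [AddCommGroup A] (H : AddSubgroup A) : H ≤ saturation H :=
  fun a ha => ⟨1, one_ne_zero, by simpa using ha⟩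

/-! ### The group of mixed modular symbols -/

/-- The matrix `U = [1, -1; 1, 0]`. -/
def U : SL(2, ℤ) := ⟨!![1, -1; 1, 0], by simp [Matrix.det_fin_two]⟩

/-- The free generator attached to a pair `(g, g')`. -/
abbrev gen (g g' : SL(2, ℤ)) : FreeAbelianGroup (SL(2, ℤ) × SL(2, ℤ)) :=
  FreeAbelianGroup.of (g, g')

/-- The three families of defining relations between the symbols `{g, g'}`. -/
inductive IsRelation : FreeAbelianGroup (SL(2, ℤ) × SL(2, ℤ)) → Prop
  | chasles (g g' g'' : SL(2, ℤ)) : IsRelation (gen g g' + gen g' g'' + gen g'' g)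
  | sign (g g' ε₁ ε₂ : SL(2, ℤ)) (h₁ : ε₁ = 1 ∨ ε₁ = -1) (h₂ : ε₂ = 1 ∨ ε₂ = -1) :
      IsRelation (gen g g' - gen (ε₁ * g) (ε₂ * g'))
  | parabolic (g : SL(2, ℤ)) (n : ℤ) : IsRelation (gen g (g * T ^ n) - n • gen g (g * T))

/-- The subgroup of relations of the torsion-free group generated by the symbols `{g, g'}`. -/
def relations : AddSubgroup (FreeAbelianGroup (SL(2, ℤ) × SL(2, ℤ))) :=
  saturation (AddSubgroup.closure {x | IsRelation x})

/-- The torsion-free abelian group `M̃` generated by the symbols `{g, g'}`. -/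
def Symbols : Type := FreeAbelianGroup (SL(2, ℤ) × SL(2, ℤ)) ⧸ relations

instance : AddCommGroup Symbols :=
  inferInstanceAs (AddCommGroup (FreeAbelianGroup (SL(2, ℤ) × SL(2, ℤ)) ⧸ relations))

/-- The projection from the free group onto `M̃`. -/
def toSymbols : FreeAbelianGroup (SL(2, ℤ) × SL(2, ℤ)) →+ Symbols :=
  QuotientAddGroup.mk' relations

/-- The symbol `{g, g'}` in `M̃`. -/
def symb (g g' : SL(2, ℤ)) : Symbols := toSymbols (gen g g')

/-- Left translation of the free generators. -/
def freeTranslate (γ : SL(2, ℤ)) :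
    FreeAbelianGroup (SL(2, ℤ) × SL(2, ℤ)) →+ FreeAbelianGroup (SL(2, ℤ) × SL(2, ℤ)) :=
  FreeAbelianGroup.map fun x => (γ * x.1, γ * x.2)

theorem freeTranslate_gen (γ g g' : SL(2, ℤ)) :
    freeTranslate γ (gen g g') = gen (γ * g) (γ * g') := by
  simp [freeTranslate, gen]

theorem IsRelation.translate {x : FreeAbelianGroup (SL(2, ℤ) × SL(2, ℤ))} (hx : IsRelation x)
    (γ : SL(2, ℤ)) : IsRelation (freeTranslate γ x) := by
  cases hx with
  | chasles g g' g'' =>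
    simp only [map_add, freeTranslate_gen]
    exact .chasles _ _ _
  | sign g g' ε₁ ε₂ h₁ h₂ =>
    have key : ∀ ε h : SL(2, ℤ), (ε = 1 ∨ ε = -1) → γ * (ε * h) = ε * (γ * h) := by
      rintro ε h (rfl | rfl) <;> simp
    simp only [map_sub, freeTranslate_gen, key _ _ h₁, key _ _ h₂]
    exact .sign _ _ _ _ h₁ h₂
  | parabolic g n =>
    simp only [map_sub, map_zsmul, freeTranslate_gen, ← mul_assoc]
    exact .parabolic _ _

theorem relations_le_comap (γ : SL(2, ℤ)) : relations ≤ relations.comap (freeTranslate γ) := by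
  rintro x ⟨n, hn, hx⟩
  refine ⟨n, hn, ?_⟩
  rw [← map_nsmul]
  have h : AddSubgroup.closure {x | IsRelation x} ≤
      (AddSubgroup.closure {x | IsRelation x}).comap (freeTranslate γ) := by
    rw [AddSubgroup.closure_le]
    exact fun y hy => AddSubgroup.subset_closure (IsRelation.translate hy γ)
  exact h hx

/-- The left action of `SL(2, ℤ)` on `M̃`, given by `γ · {g, g'} = {γ g, γ g'}`. -/
def translate (γ : SL(2, ℤ)) : Symbols →+ Symbols :=
  QuotientAddGroup.map relations relations (freeTranslate γ) (relations_le_comap γ)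

theorem translate_symb (γ g g' : SL(2, ℤ)) :
    translate γ (symb g g') = symb (γ * g) (γ * g') := by
  change toSymbols (freeTranslate γ (gen g g')) = _
  rw [freeTranslate_gen]
  rfl

/-- The kernel of the projection from `M̃` onto its largest torsion-free quotient on which `Γ` acts
trivially. -/
def coinvariantRelations (Γ : Subgroup SL(2, ℤ)) : AddSubgroup Symbols :=
  saturation (AddSubgroup.closure {x | ∃ γ ∈ Γ, ∃ m : Symbols, x = translate γ m - m})

/-- The group `M̃_Γ` of mixed modular symbols of level `Γ`: the largest torsion-free quotient of `M̃`
on which `Γ` acts trivially. -/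
def SymbolsLevel (Γ : Subgroup SL(2, ℤ)) : Type := Symbols ⧸ coinvariantRelations Γ

instance (Γ : Subgroup SL(2, ℤ)) : AddCommGroup (SymbolsLevel Γ) :=
  inferInstanceAs (AddCommGroup (Symbols ⧸ coinvariantRelations Γ))

/-- The projection from `M̃` onto `M̃_Γ`. -/
def toLevel (Γ : Subgroup SL(2, ℤ)) : Symbols →+ SymbolsLevel Γ :=
  QuotientAddGroup.mk' (coinvariantRelations Γ)

/-- The symbol `{g, g'}` in `M̃_Γ`. -/
def symbLevel (Γ : Subgroup SL(2, ℤ)) (g g' : SL(2, ℤ)) : SymbolsLevel Γ :=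
  toLevel Γ (symb g g')

theorem symbLevel_translate {Γ : Subgroup SL(2, ℤ)} {γ : SL(2, ℤ)} (hγ : γ ∈ Γ)
    (g g' : SL(2, ℤ)) : symbLevel Γ (γ * g) (γ * g') = symbLevel Γ g g' := by
  refine (QuotientAddGroup.eq.mpr (le_saturation _ (AddSubgroup.subset_closure ?_))).symm
  exact ⟨γ, hγ, symb g g', by rw [translate_symb]; abel⟩

theorem symb_sign (g g' ε₁ ε₂ : SL(2, ℤ)) (h₁ : ε₁ = 1 ∨ ε₁ = -1) (h₂ : ε₂ = 1 ∨ ε₂ = -1) :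
    symb (ε₁ * g) (ε₂ * g') = symb g g' := by
  refine QuotientAddGroup.eq.mpr (le_saturation _ ?_)
  have h := AddSubgroup.subset_closure (k := {x | IsRelation x}) (.sign g g' ε₁ ε₂ h₁ h₂)
  rwa [sub_eq_neg_add] at h

/-! ### The coset space `Γ \ PSL₂(ℤ)` -/

/-- The projection `SL₂(ℤ) → PSL₂(ℤ)`. -/
abbrev toPSL : SL(2, ℤ) →* PSL(2, ℤ) := QuotientGroup.mk' (Subgroup.center SL(2, ℤ))

theorem eq_one_or_neg_one_of_mem_center {ε : SL(2, ℤ)} (hε : ε ∈ Subgroup.center SL(2, ℤ)) :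
    ε = 1 ∨ ε = -1 := by
  obtain ⟨r, hr, h⟩ := Matrix.SpecialLinearGroup.mem_center_iff.mp hε
  rw [Fintype.card_fin] at hr
  rcases (by simpa using hr : r = 1 ∨ r = -1) with rfl | rfl
  · left; ext i j; simp [← h]
  · right; ext i j; simp [← h]

/-- The set `Γ \ PSL₂(ℤ)` of right cosets of the image of `Γ` in `PSL₂(ℤ)`. -/
abbrev Cosets (Γ : Subgroup SL(2, ℤ)) : Type := Quotient (QuotientGroup.rightRel (Γ.map toPSL))

/-- The coset `Γ g`. -/
def coset (Γ : Subgroup SL(2, ℤ)) (g : PSL(2, ℤ)) : Cosets Γ := Quotient.mk _ g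

/-- Right multiplication `Γ g ↦ Γ g h` on `Γ \ PSL₂(ℤ)`. -/
def cosetMul (Γ : Subgroup SL(2, ℤ)) (h : PSL(2, ℤ)) : Cosets Γ → Cosets Γ :=
  Quotient.map (fun g => g * h) (by
    intro a b hab
    have hab' := QuotientGroup.rightRel_apply.mp hab
    exact QuotientGroup.rightRel_apply.mpr (by simpa [mul_assoc] using hab'))

/-- The subgroup `ℤ[Γ \ PSL₂(ℤ)]^h` of the elements fixed by right multiplication by `h`. -/
def fixedBy (Γ : Subgroup SL(2, ℤ)) (h : SL(2, ℤ)) : AddSubgroup (Cosets Γ →₀ ℤ) where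
  carrier := {x | Finsupp.mapDomain (cosetMul Γ (toPSL h)) x = x}
  zero_mem' := Finsupp.mapDomain_zero
  add_mem' := fun {a b} ha hb => by
    change Finsupp.mapDomain _ (a + b) = a + b
    rw [Finsupp.mapDomain_add, ha, hb]
  neg_mem' := fun {a} ha => by
    change Finsupp.mapDomain.addMonoidHom (cosetMul Γ (toPSL h)) (-a) = -a
    rw [map_neg]
    exact congrArg _ ha

/-- A function on `SL₂(ℤ)` invariant under left translation by `Γ` and `-1` descends to
`Γ \ PSL₂(ℤ)`. -/
def liftCosets {Γ : Subgroup SL(2, ℤ)} {β : Sort*} (f : SL(2, ℤ) → β)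
    (hΓ : ∀ γ ∈ Γ, ∀ g, f (γ * g) = f g) (hneg : ∀ g, f (-g) = f g) : Cosets Γ → β :=
  have hc : ∀ a ε : SL(2, ℤ), ε ∈ Subgroup.center SL(2, ℤ) → f (ε * a) = f a := by
    intro a ε hε
    rcases eq_one_or_neg_one_of_mem_center hε with rfl | rfl <;> simp [hneg]
  Quotient.lift
    (fun g : PSL(2, ℤ) => Quotient.lift f (fun a b hab => by
      have h := QuotientGroup.leftRel_apply.mp hab
      have h' := hc a _ h
      rw [Subgroup.mem_center_iff.mp h a |>.symm] at h'
      simpa using h'.symm) g)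
    (fun a b hab => by
      obtain ⟨γ, hγ, h⟩ := QuotientGroup.rightRel_apply.mp hab
      induction a using QuotientGroup.induction_on with | H a => ?_
      obtain rfl : b = toPSL (γ * a) := by
        rw [map_mul, h]
        exact (inv_mul_cancel_right b _).symm
      exact (hΓ γ hγ a).symm)

@[simp]
theorem liftCosets_coset {Γ : Subgroup SL(2, ℤ)} {β : Sort*} (f : SL(2, ℤ) → β)
    (hΓ : ∀ γ ∈ Γ, ∀ g, f (γ * g) = f g) (hneg : ∀ g, f (-g) = f g) (g : SL(2, ℤ)) :
    liftCosets f hΓ hneg (coset Γ (toPSL g)) = f g := rfl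

/-- The Manin symbol `Γ g ↦ {g, g S}`. -/
def maninSymbol (Γ : Subgroup SL(2, ℤ)) : Cosets Γ → SymbolsLevel Γ :=
  liftCosets (fun g => symbLevel Γ g (g * S))
    (fun γ hγ g => by rw [mul_assoc]; exact symbLevel_translate hγ _ _)
    (fun g => congrArg (toLevel Γ) (by
      simpa using symb_sign g (g * S) (-1) (-1) (.inr rfl) (.inr rfl)))

/-- The Manin map `ξ̃_Γ : ℤ[Γ \ PSL₂(ℤ)] → M̃_Γ`, `Γ g ↦ {g, g S}`. -/
noncomputable def maninMap (Γ : Subgroup SL(2, ℤ)) : (Cosets Γ →₀ ℤ) →+ SymbolsLevel Γ :=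
  Finsupp.liftAddHom fun x => (zmultiplesHom (SymbolsLevel Γ)) (maninSymbol Γ x)

/-! ### Cusps -/

/-- The set of cusps `Γ \ ℙ¹(ℚ)`. -/
abbrev Cusps (Γ : Subgroup SL(2, ℤ)) : Type :=
  MulAction.orbitRel.Quotient (Γ.map (Matrix.SpecialLinearGroup.mapGL ℚ)) (OnePoint ℚ)

/-- The cusp `Γ g ∞`. -/
noncomputable def cusp (Γ : Subgroup SL(2, ℤ)) (g : SL(2, ℤ)) : Cusps Γ :=
  Quotient.mk _ (Matrix.SpecialLinearGroup.mapGL ℚ g • (OnePoint.infty : OnePoint ℚ))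

theorem cusp_mul {Γ : Subgroup SL(2, ℤ)} {γ : SL(2, ℤ)} (hγ : γ ∈ Γ) (g : SL(2, ℤ)) :
    cusp Γ (γ * g) = cusp Γ g := by
  refine Quotient.sound ⟨⟨_, γ, hγ, rfl⟩, ?_⟩
  simp [mul_smul, Subgroup.smul_def]

theorem cusp_neg (Γ : Subgroup SL(2, ℤ)) (g : SL(2, ℤ)) : cusp Γ (-g) = cusp Γ g := by
  refine congrArg (Quotient.mk _) ?_
  simp [OnePoint.smul_infty_eq_ite]

theorem cusp_surjective (Γ : Subgroup SL(2, ℤ)) : Function.Surjective (cusp Γ) := by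
  intro c
  induction c using Quotient.inductionOn with | h x => ?_
  obtain ⟨g, rfl⟩ := OnePoint.exists_mem_SL2 ℤ x
  exact ⟨g, rfl⟩

/-- The map `Γ \ PSL₂(ℤ) → Γ \ ℙ¹(ℚ)`, `Γ g ↦ Γ g ∞`. -/
noncomputable def cosetCusp (Γ : Subgroup SL(2, ℤ)) : Cosets Γ → Cusps Γ :=
  liftCosets (cusp Γ) (fun _ hγ g => cusp_mul hγ g) (cusp_neg Γ)

instance finite_cusps (Γ : Subgroup SL(2, ℤ)) [Γ.FiniteIndex] : Finite (Cusps Γ) := by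
  refine Finite.of_surjective (fun x : SL(2, ℤ) ⧸ Γ => Quotient.lift (fun g => cusp Γ g⁻¹) ?_ x) ?_
  · intro a b hab
    have h := QuotientGroup.leftRel_apply.mp hab
    have h' := cusp_mul h b⁻¹
    simpa using h'
  · intro c
    obtain ⟨g, rfl⟩ := cusp_surjective Γ c
    exact ⟨QuotientGroup.mk g⁻¹, by
      change cusp Γ (g⁻¹)⁻¹ = cusp Γ g
      rw [inv_inv]⟩

/-- The width `e_c` of a cusp `c = Γ g ∞`, that is the ramification index of `X_Γ → X_{SL₂(ℤ)}` at
`c`: the least `h > 0` with `± g T ^ h g⁻¹ ∈ Γ`.  (This condition on `h` is the same for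
all `g` with `c = Γ g ∞`.) -/
noncomputable def width (Γ : Subgroup SL(2, ℤ)) (c : Cusps Γ) : ℕ :=
  sInf {h | 0 < h ∧ ∃ g : SL(2, ℤ), cusp Γ g = c ∧
    (g * T ^ h * g⁻¹ ∈ Γ ∨ -(g * T ^ h * g⁻¹) ∈ Γ)}

/-- The greatest common divisor `d_Γ` of the widths of the cusps. -/
noncomputable def widthGcd (Γ : Subgroup SL(2, ℤ)) [Γ.FiniteIndex] : ℕ :=
  letI := Fintype.ofFinite (Cusps Γ)
  Finset.univ.gcd (width Γ)

/-- The element `(1 / d_Γ) ∑_c e_c [c]` of `ℤ[C_Γ]`. -/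
noncomputable def widthElement (Γ : Subgroup SL(2, ℤ)) [Γ.FiniteIndex] : Cusps Γ →₀ ℤ :=
  Finsupp.equivFunOnFinite.symm fun c => ((width Γ c / widthGcd Γ : ℕ) : ℤ)

/-- The group `ℤ[C_Γ]_0`, quotient of `ℤ[C_Γ]` by the element `(1 / d_Γ) ∑_c e_c [c]`. -/
def CuspQuotient (Γ : Subgroup SL(2, ℤ)) [Γ.FiniteIndex] : Type :=
  (Cusps Γ →₀ ℤ) ⧸ AddSubgroup.zmultiples (widthElement Γ)

noncomputable instance (Γ : Subgroup SL(2, ℤ)) [Γ.FiniteIndex] : AddCommGroup (CuspQuotient Γ) :=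
  inferInstanceAs (AddCommGroup ((Cusps Γ →₀ ℤ) ⧸ AddSubgroup.zmultiples (widthElement Γ)))

/-- The projection from `ℤ[C_Γ]` onto `ℤ[C_Γ]_0`. -/
noncomputable def toCuspQuotient (Γ : Subgroup SL(2, ℤ)) [Γ.FiniteIndex] :
    (Cusps Γ →₀ ℤ) →+ CuspQuotient Γ :=
  QuotientAddGroup.mk' (AddSubgroup.zmultiples (widthElement Γ))

/-- The class `(c)` of a cusp `c` in `ℤ[C_Γ]_0`. -/
noncomputable def cuspClass (Γ : Subgroup SL(2, ℤ)) [Γ.FiniteIndex] (c : Cusps Γ) :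
    CuspQuotient Γ :=
  toCuspQuotient Γ (Finsupp.single c 1)

/-- The homomorphism `φ_Γ : ℤ[Γ \ PSL₂(ℤ)] → ℤ[C_Γ]_0`, `Γ g ↦ (Γ g ∞)`. -/
noncomputable def cuspMap (Γ : Subgroup SL(2, ℤ)) [Γ.FiniteIndex] :
    (Cosets Γ →₀ ℤ) →+ CuspQuotient Γ :=
  Finsupp.liftAddHom fun x => (zmultiplesHom (CuspQuotient Γ)) (cuspClass Γ (cosetCusp Γ x))

end MixedModularSymbols

namespace MixedModularSymbols

/-! ### `PSL₂(ℤ)` is the free product of the groups generated by `S` and `U` -/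

/-! Write X for Γ\PSL₂(ℤ). Since `S` and `U` generate, M̃_Γ is generated by the symbols {g, gS} and
{g, gU}. Up to saturation, the relations between them are of three kinds: S-invariant combinations
of the first family vanish, U-invariant combinations of the second vanish, and so does the pair (yU,
y) for y = zT − z, which is the parabolic relation because T = US in PSL₂(ℤ). That there are no
others (`symbolMap_add_eq_zero_iff`) rests on PSL₂(ℤ) being the free product of ⟨S⟩ and ⟨U⟩: values
prescribed on S and U subject to these relations extend to a one-cocycle, hence to a map out of
M̃_Γ.

The saturation is made explicit in `mem_pairRelations_iff_exists`. If n(a, b) is a relation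
involving y = zT − z, then y is invariant under S and U modulo n, so y = kΣ + nw by transitivity,
where Σ is the sum of all cosets. Cusps are the T-orbits on X and widths are their lengths, so y
maps to 0 and Σ to ∑ e_c[c]. Hence n divides every k e_c, so it divides k d_Γ, and w lies in Ker
φ_Γ; this is where the normalization by d_Γ enters. Thus (a, b) is a relation exactly when some w in
Ker φ_Γ makes a − wU S-invariant and b − w U-invariant. Taking b = 0 gives the kernel of the Manin
map; projecting to b gives its cokernel.

For the index, the cokernel classes of the vertices of a Farey triangle add up to zero, so the two
vertices opposite a common edge agree. At odd level this identifies all cusp classes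
(`cuspCokerClass_eq_one`), and the cokernel is cyclic of order dividing 3. It is trivial if U fixes
a coset; if U fixes none and T lies in Γ, the degree modulo 3 shows that it is not (`index_ne_one`).
A fixed coset amounts to a conjugate of ±U in Γ, which is decided by the trace for Γ₁ and by the
roots of a² − a + 1 for Γ₀. -/

theorem mul_entry (g h : SL(2, ℤ)) (i j : Fin 2) :
    (g * h) i j = g i 0 * h 0 j + g i 1 * h 1 j := by
  rw [Matrix.SpecialLinearGroup.coe_mul, Matrix.mul_apply, Fin.sum_univ_two]

theorem coe_U : (U : Matrix (Fin 2) (Fin 2) ℤ) = !![1, -1; 1, 0] := rfl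

theorem S_mul_S : S * S = -1 := by
  ext i j; fin_cases i <;> fin_cases j <;> rfl

theorem U_mul_U_mul_U : U * U * U = -1 := by
  ext i j; fin_cases i <;> fin_cases j <;> rfl

theorem T_mul_S : T * S = U := by
  ext i j; fin_cases i <;> fin_cases j <;> rfl

theorem U_mul_S : U * S = -T := by
  rw [← T_mul_S, mul_assoc, S_mul_S]; simp

theorem toPSL_neg (g : SL(2, ℤ)) : toPSL (-g) = toPSL g := by
  refine QuotientGroup.eq.mpr ?_
  rw [Subgroup.mem_center_iff]
  intro h; simp

theorem toPSL_eq_iff {g h : SL(2, ℤ)} : toPSL g = toPSL h ↔ g = h ∨ g = -h := by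
  constructor
  · intro e
    rcases eq_one_or_neg_one_of_mem_center (QuotientGroup.eq.mp e) with h1 | h1
    · left; exact (inv_mul_eq_one.mp h1)
    · right
      rw [inv_mul_eq_iff_eq_mul] at h1
      simp [h1]
  · rintro (rfl | rfl)
    · rfl
    · exact toPSL_neg h

theorem toPSL_S_sq : toPSL S ^ 2 = 1 := by
  rw [pow_two, ← map_mul, S_mul_S, toPSL_neg, map_one]

theorem toPSL_U_cube : toPSL U ^ 3 = 1 := by
  rw [pow_succ, pow_two, ← map_mul, ← map_mul, U_mul_U_mul_U, toPSL_neg, map_one]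

theorem toPSL_T : toPSL T = toPSL U * toPSL S := by
  rw [← map_mul, U_mul_S, toPSL_neg]

theorem closure_S_U : Subgroup.closure {S, U} = (⊤ : Subgroup SL(2, ℤ)) := by
  rw [eq_top_iff, ← SpecialLinearGroup.SL2Z_generators, Subgroup.closure_le]
  have hS : S ∈ Subgroup.closure {S, U} := Subgroup.subset_closure (by simp)
  have hU : U ∈ Subgroup.closure {S, U} := Subgroup.subset_closure (by simp)
  rintro x (rfl | rfl)
  · exact hS
  · have : T = U * S⁻¹ := by rw [← T_mul_S, mul_inv_cancel_right]
    rw [SetLike.mem_coe, this]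
    exact mul_mem hU (inv_mem hS)

/-- A subgroup of `SL₂(ℤ)` containing `S` and `U` contains everything. -/
theorem mem_of_S_mem_of_U_mem {H : Subgroup SL(2, ℤ)} (hS : S ∈ H) (hU : U ∈ H) (g : SL(2, ℤ)) :
    g ∈ H := by
  have : Subgroup.closure {S, U} ≤ H := by
    rw [Subgroup.closure_le]
    rintro x (rfl | rfl) <;> assumption
  exact this (closure_S_U ▸ Subgroup.mem_top g)

/-- The homomorphism from `ℤ/n` to a group given by an element whose `n`-th power is `1`. -/
def zmodHom {K : Type*} [Group K] (n : ℕ) (k : K) (hk : k ^ n = 1) :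
    Multiplicative (ZMod n) →* K :=
  AddMonoidHom.toMultiplicativeLeft
    (ZMod.lift n ⟨(zmultiplesHom (Additive K)) (Additive.ofMul k), by
      simpa using congrArg Additive.ofMul hk⟩)

theorem zmodHom_intCast {K : Type*} [Group K] (n : ℕ) (k : K) (hk : k ^ n = 1) (m : ℤ) :
    zmodHom n k hk (Multiplicative.ofAdd (m : ZMod n)) = k ^ m := by
  change Additive.toMul (ZMod.lift n _ (m : ZMod n)) = _
  rw [ZMod.lift_coe]
  simp

theorem zmodHom_one {K : Type*} [Group K] (n : ℕ) (k : K) (hk : k ^ n = 1) :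
    zmodHom n k hk (Multiplicative.ofAdd 1) = k := by
  simpa using zmodHom_intCast n k hk 1

/-- The orders of `S` and `U` in `PSL₂(ℤ)`. -/
def factorOrder (i : Bool) : ℕ := if i then 3 else 2

/-- The homomorphisms from the two cyclic factors to a group. -/
def factorHom {K : Type*} [Group K] (s u : K) (hs : s ^ 2 = 1) (hu : u ^ 3 = 1) :
    (i : Bool) → Multiplicative (ZMod (factorOrder i)) →* K
  | false => zmodHom 2 s hs
  | true => zmodHom 3 u hu

theorem lift_factorHom_false {K : Type*} [Group K] (s u : K) (hs : s ^ 2 = 1) (hu : u ^ 3 = 1) :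
    Monoid.CoprodI.lift (factorHom s u hs hu)
      (Monoid.CoprodI.of (i := false) (Multiplicative.ofAdd (1 : ZMod 2))) = s :=
  (Monoid.CoprodI.lift_of ..).trans (zmodHom_one 2 s hs)

theorem lift_factorHom_true {K : Type*} [Group K] (s u : K) (hs : s ^ 2 = 1) (hu : u ^ 3 = 1) :
    Monoid.CoprodI.lift (factorHom s u hs hu)
      (Monoid.CoprodI.of (i := true) (Multiplicative.ofAdd (1 : ZMod 3))) = u :=
  (Monoid.CoprodI.lift_of ..).trans (zmodHom_one 3 u hu)

/-- The sets used to play ping-pong: the classes of the matrices whose first column has entries of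
opposite signs, respectively of the same sign. -/
def pingPongSet (i : Bool) : Set PSL(2, ℤ) :=
  {x | ∃ g : SL(2, ℤ), x = toPSL g ∧ if i then 0 < g 0 0 * g 1 0 else g 0 0 * g 1 0 < 0}

theorem mem_pingPongSet_true {g : SL(2, ℤ)} (h : 0 < g 0 0 * g 1 0) :
    toPSL g ∈ pingPongSet true := ⟨g, rfl, by simpa using h⟩

theorem mem_pingPongSet_false {g : SL(2, ℤ)} (h : g 0 0 * g 1 0 < 0) :
    toPSL g ∈ pingPongSet false := ⟨g, rfl, by simpa using h⟩

theorem pingPongSet_disjoint : Disjoint (pingPongSet true) (pingPongSet false) := by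
  rw [Set.disjoint_left]
  rintro _ ⟨g, rfl, hg⟩ ⟨h, e, hh⟩
  simp only [if_true, Bool.false_eq_true, if_false] at hg hh
  rcases toPSL_eq_iff.mp e with rfl | rfl
  · exact lt_asymm hg hh
  · simp at hg; exact lt_asymm hg hh

/-- Ping-pong on the first column (x, y): S sends it to (−y, x), turning equal signs into opposite
ones, while U and U² send it to (x − y, x) and (−y, x − y), turning opposite signs into equal ones.
-/
theorem factorHom_lift_injective :
    Function.Injective (Monoid.CoprodI.lift
      (factorHom (toPSL S) (toPSL U) toPSL_S_sq toPSL_U_cube)) := by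
  refine Monoid.CoprodI.lift_injective_of_ping_pong _ ?_ pingPongSet ?_ ?_ ?_
  -- Ping-pong for two factors needs one of them to have at least three elements; here it is ⟨U⟩.
  · refine .inr ⟨true, ?_⟩
    change 3 ≤ Cardinal.mk (ZMod 3)
    simp
  · rintro (_ | _)
    · refine ⟨_, mem_pingPongSet_false (g := ⟨!![1, 0; -1, 1], by simp [Matrix.det_fin_two]⟩) ?_⟩
      simp
    · refine ⟨_, mem_pingPongSet_true (g := ⟨!![1, 0; 1, 1], by simp [Matrix.det_fin_two]⟩) ?_⟩
      simp
  · rintro (_ | _) (_ | _) h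
    · exact absurd rfl h
    · exact pingPongSet_disjoint.symm
    · exact pingPongSet_disjoint
    · exact absurd rfl h
  · rintro (_ | _) (_ | _) h
    · exact absurd rfl h
    · intro a ha
      have hh : ∀ a : ZMod 2, a ≠ 0 → a = ((1 : ℤ) : ZMod 2) := by decide
      obtain rfl : a = Multiplicative.ofAdd ((1 : ℤ) : ZMod 2) := hh a ha
      rintro _ ⟨_, ⟨g, rfl, hg⟩, rfl⟩
      change zmodHom 2 _ toPSL_S_sq _ * _ ∈ _
      rw [zmodHom_intCast, zpow_one, ← map_mul]
      apply mem_pingPongSet_false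
      simp only [if_true] at hg
      simp [coe_S, mul_entry]
      linarith
    · intro a ha
      have hh : ∀ a : ZMod 3, a ≠ 0 → a = ((1 : ℤ) : ZMod 3) ∨ a = ((2 : ℤ) : ZMod 3) := by decide
      rintro _ ⟨_, ⟨g, rfl, hg⟩, rfl⟩
      simp only [Bool.false_eq_true, if_false] at hg
      rcases hh a ha with h | h
      · obtain rfl : a = Multiplicative.ofAdd ((1 : ℤ) : ZMod 3) := h
        change zmodHom 3 _ toPSL_U_cube _ * _ ∈ _
        rw [zmodHom_intCast, zpow_one, ← map_mul]
        apply mem_pingPongSet_true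
        simp [coe_U, mul_entry]
        nlinarith [sq_nonneg (g 0 0)]
      · obtain rfl : a = Multiplicative.ofAdd ((2 : ℤ) : ZMod 3) := h
        change zmodHom 3 _ toPSL_U_cube _ * _ ∈ _
        rw [zmodHom_intCast, zpow_two, ← map_mul, ← map_mul]
        apply mem_pingPongSet_true
        simp [coe_U, mul_entry]
        nlinarith [sq_nonneg (g 1 0)]
    · exact absurd rfl h

theorem factorHom_lift_surjective :
    Function.Surjective (Monoid.CoprodI.lift
      (factorHom (toPSL S) (toPSL U) toPSL_S_sq toPSL_U_cube)) := by
  set f := Monoid.CoprodI.lift (factorHom (toPSL S) (toPSL U) toPSL_S_sq toPSL_U_cube) with hf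
  intro x
  obtain ⟨g, rfl⟩ := QuotientGroup.mk'_surjective _ x
  refine mem_of_S_mem_of_U_mem (H := f.range.comap toPSL) ?_ ?_ g
  · exact ⟨_, lift_factorHom_false ..⟩
  · exact ⟨_, lift_factorHom_true ..⟩

/-- The universal property of `PSL₂(ℤ)` as the group generated by `S` and `U` subject to
`S ^ 2 = U ^ 3 = 1`. -/
theorem exists_hom_of_sq_eq_one_of_cube_eq_one {K : Type*} [Group K] (s u : K) (hs : s ^ 2 = 1)
    (hu : u ^ 3 = 1) : ∃ θ : PSL(2, ℤ) →* K, θ (toPSL S) = s ∧ θ (toPSL U) = u := by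
  let e := MulEquiv.ofBijective _ ⟨factorHom_lift_injective, factorHom_lift_surjective⟩
  refine ⟨(Monoid.CoprodI.lift (factorHom s u hs hu)).comp e.symm.toMonoidHom, ?_, ?_⟩
  · refine Eq.trans (congrArg (Monoid.CoprodI.lift _) ?_) (lift_factorHom_false s u hs hu)
    exact e.symm_apply_eq.mpr (lift_factorHom_false _ _ toPSL_S_sq toPSL_U_cube).symm
  · refine Eq.trans (congrArg (Monoid.CoprodI.lift _) ?_) (lift_factorHom_true s u hs hu)
    exact e.symm_apply_eq.mpr (lift_factorHom_true _ _ toPSL_S_sq toPSL_U_cube).symm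

/-! ### Saturations -/

section Saturation

variable {A B : Type*} [AddCommGroup A] [AddCommGroup B]

theorem mem_saturation_of_nsmul_mem {H : AddSubgroup A} {n : ℕ} (hn : n ≠ 0) {a : A}
    (h : n • a ∈ saturation H) : a ∈ saturation H := by
  obtain ⟨m, hm, h⟩ := h
  exact ⟨m * n, mul_ne_zero hm hn, by rwa [mul_smul]⟩

theorem eq_zero_of_nsmul_eq_zero_quotient_saturation {H : AddSubgroup A} {n : ℕ} (hn : n ≠ 0)
    {a : A ⧸ saturation H} (h : n • a = 0) : a = 0 := by
  induction a using QuotientAddGroup.induction_on with | H a => ?_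
  rw [QuotientAddGroup.eq_zero_iff]
  rw [← QuotientAddGroup.mk_nsmul, QuotientAddGroup.eq_zero_iff] at h
  exact mem_saturation_of_nsmul_mem hn h

theorem saturation_le_ker {H : AddSubgroup A} (f : A →+ B)
    (hB : ∀ (n : ℕ) (b : B), n ≠ 0 → n • b = 0 → b = 0) (hH : H ≤ f.ker) :
    saturation H ≤ f.ker := by
  rintro a ⟨n, hn, ha⟩
  refine hB n _ hn ?_
  rw [← map_nsmul]
  exact hH ha

end Saturation

/-! ### Right multiplication on `ℤ[Γ \ PSL₂(ℤ)]` -/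

section RightMul

variable (Γ : Subgroup SL(2, ℤ))

@[simp]
theorem cosetMul_coset (g h : PSL(2, ℤ)) : cosetMul Γ h (coset Γ g) = coset Γ (g * h) := rfl

theorem exists_coset_eq (x : Cosets Γ) : ∃ g : SL(2, ℤ), coset Γ (toPSL g) = x := by
  induction x using Quotient.inductionOn with | h x => ?_
  obtain ⟨g, rfl⟩ := QuotientGroup.mk'_surjective _ x
  exact ⟨g, rfl⟩

theorem cosetMul_cosetMul (g h : PSL(2, ℤ)) (x : Cosets Γ) :
    cosetMul Γ h (cosetMul Γ g x) = cosetMul Γ (g * h) x := by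
  obtain ⟨a, rfl⟩ := exists_coset_eq Γ x
  simp [mul_assoc]

@[simp]
theorem cosetMul_one (x : Cosets Γ) : cosetMul Γ 1 x = x := by
  obtain ⟨a, rfl⟩ := exists_coset_eq Γ x
  simp

theorem coset_eq_iff {g h : SL(2, ℤ)} :
    coset Γ (toPSL g) = coset Γ (toPSL h) ↔ h * g⁻¹ ∈ Γ ∨ -(h * g⁻¹) ∈ Γ := by
  have : coset Γ (toPSL g) = coset Γ (toPSL h) ↔ toPSL (h * g⁻¹) ∈ Γ.map toPSL := by
    rw [coset, coset, Quotient.eq, QuotientGroup.rightRel_apply, map_mul, map_inv]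
  rw [this]
  constructor
  · rintro ⟨γ, hγ, e⟩
    rcases toPSL_eq_iff.mp e with rfl | rfl
    · exact .inl hγ
    · exact .inr hγ
  · rintro (h | h)
    · exact ⟨_, h, rfl⟩
    · exact ⟨_, h, toPSL_neg _⟩

theorem coset_mul_left {γ : SL(2, ℤ)} (hγ : γ ∈ Γ) (g : SL(2, ℤ)) :
    coset Γ (toPSL γ * toPSL g) = coset Γ (toPSL g) := by
  rw [← map_mul, coset_eq_iff]
  left
  simpa using Γ.inv_mem hγ

/-- Right multiplication by `h` as a permutation of the cosets. -/
def cosetPerm (h : PSL(2, ℤ)) : Equiv.Perm (Cosets Γ) where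
  toFun := cosetMul Γ h
  invFun := cosetMul Γ h⁻¹
  left_inv x := by simp [cosetMul_cosetMul]
  right_inv x := by simp [cosetMul_cosetMul]

theorem cosetMul_injective (h : PSL(2, ℤ)) : Function.Injective (cosetMul Γ h) :=
  (cosetPerm Γ h).injective

/-- Right multiplication by `h` on `ℤ[Γ \ PSL₂(ℤ)]`. -/
noncomputable def rightMul (h : SL(2, ℤ)) : (Cosets Γ →₀ ℤ) →+ (Cosets Γ →₀ ℤ) :=
  Finsupp.mapDomain.addMonoidHom (cosetMul Γ (toPSL h))

@[simp]
theorem rightMul_single (h : SL(2, ℤ)) (x : Cosets Γ) (n : ℤ) :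
    rightMul Γ h (Finsupp.single x n) = Finsupp.single (cosetMul Γ (toPSL h) x) n :=
  Finsupp.mapDomain_single

theorem rightMul_rightMul (g h : SL(2, ℤ)) (a : Cosets Γ →₀ ℤ) :
    rightMul Γ h (rightMul Γ g a) = rightMul Γ (g * h) a := by
  induction a using Finsupp.induction_linear with
  | zero => simp
  | add a b ha hb => simp only [map_add, ha, hb]
  | single x n => simp [cosetMul_cosetMul]

theorem rightMul_neg_one (a : Cosets Γ →₀ ℤ) : rightMul Γ (-1) a = a := by
  induction a using Finsupp.induction_linear with
  | zero => simp
  | add a b ha hb => simp only [map_add, ha, hb]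
  | single x n => rw [rightMul_single, toPSL_neg, map_one, cosetMul_one]

theorem mem_fixedBy {h : SL(2, ℤ)} {a : Cosets Γ →₀ ℤ} : a ∈ fixedBy Γ h ↔ rightMul Γ h a = a :=
  Iff.rfl

theorem rightMul_apply (h : SL(2, ℤ)) (a : Cosets Γ →₀ ℤ) (x : Cosets Γ) :
    rightMul Γ h a (cosetMul Γ (toPSL h) x) = a x :=
  Finsupp.mapDomain_apply (cosetMul_injective Γ _) a x

theorem mem_fixedBy_of_nsmul_mem {h : SL(2, ℤ)} {n : ℕ} (hn : n ≠ 0) {a : Cosets Γ →₀ ℤ}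
    (ha : n • a ∈ fixedBy Γ h) : a ∈ fixedBy Γ h := by
  rw [mem_fixedBy, map_nsmul] at ha
  exact nsmul_right_injective hn ha

theorem add_rightMul_S_mem_fixedBy (a : Cosets Γ →₀ ℤ) : a + rightMul Γ S a ∈ fixedBy Γ S := by
  rw [mem_fixedBy, map_add, rightMul_rightMul, S_mul_S, rightMul_neg_one, add_comm]

theorem add_rightMul_U_mem_fixedBy (a : Cosets Γ →₀ ℤ) :
    a + rightMul Γ U a + rightMul Γ U (rightMul Γ U a) ∈ fixedBy Γ U := by
  have h : rightMul Γ U (rightMul Γ U (rightMul Γ U a)) = a := by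
    rw [rightMul_rightMul, rightMul_rightMul, ← mul_assoc, U_mul_U_mul_U, rightMul_neg_one]
  rw [mem_fixedBy, map_add, map_add, h]
  abel

end RightMul

/-! ### Symbols in `M̃_Γ` -/

section Symbols

variable (Γ : Subgroup SL(2, ℤ))

theorem SymbolsLevel.eq_zero_of_nsmul {n : ℕ} (hn : n ≠ 0) {m : SymbolsLevel Γ} (h : n • m = 0) :
    m = 0 :=
  eq_zero_of_nsmul_eq_zero_quotient_saturation hn h

/-- The projection from the free group on pairs to `M̃_Γ`. -/
def freeToLevel : FreeAbelianGroup (SL(2, ℤ) × SL(2, ℤ)) →+ SymbolsLevel Γ :=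
  (toLevel Γ).comp toSymbols

theorem freeToLevel_gen (g g' : SL(2, ℤ)) : freeToLevel Γ (gen g g') = symbLevel Γ g g' := rfl

theorem freeToLevel_surjective : Function.Surjective (freeToLevel Γ) :=
  (QuotientAddGroup.mk'_surjective _).comp (QuotientAddGroup.mk'_surjective _)

theorem freeToLevel_eq_zero {x : FreeAbelianGroup (SL(2, ℤ) × SL(2, ℤ))} (hx : IsRelation x) :
    freeToLevel Γ x = 0 := by
  have : toSymbols x = 0 :=
    (QuotientAddGroup.eq_zero_iff x).mpr (le_saturation _ (AddSubgroup.subset_closure hx))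
  rw [freeToLevel, AddMonoidHom.comp_apply, this, map_zero]

theorem symbLevel_parabolic (g : SL(2, ℤ)) (n : ℤ) :
    symbLevel Γ g (g * T ^ n) = n • symbLevel Γ g (g * T) := by
  have h := freeToLevel_eq_zero Γ (.parabolic g n)
  rwa [map_sub, map_zsmul, freeToLevel_gen, freeToLevel_gen, sub_eq_zero] at h

theorem symbLevel_self (g : SL(2, ℤ)) : symbLevel Γ g g = 0 := by
  simpa using symbLevel_parabolic Γ g 0

theorem symbLevel_symm (g g' : SL(2, ℤ)) : symbLevel Γ g' g = -symbLevel Γ g g' := by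
  have h := freeToLevel_eq_zero Γ (.chasles g g' g)
  simp only [map_add, freeToLevel_gen, symbLevel_self, add_zero] at h
  exact (neg_eq_of_add_eq_zero_right h).symm

theorem symbLevel_add (g g' g'' : SL(2, ℤ)) :
    symbLevel Γ g g' + symbLevel Γ g' g'' = symbLevel Γ g g'' := by
  have h := freeToLevel_eq_zero Γ (.chasles g g' g'')
  simp only [map_add, freeToLevel_gen] at h
  rw [symbLevel_symm Γ g g''] at h
  exact add_neg_eq_zero.mp h

theorem symbLevel_neg_right (g g' : SL(2, ℤ)) : symbLevel Γ g (-g') = symbLevel Γ g g' :=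
  congrArg (toLevel Γ) (by simpa using symb_sign g g' 1 (-1) (.inl rfl) (.inr rfl))

theorem symbLevel_neg_left (g g' : SL(2, ℤ)) : symbLevel Γ (-g) g' = symbLevel Γ g g' :=
  congrArg (toLevel Γ) (by simpa using symb_sign g g' (-1) 1 (.inr rfl) (.inl rfl))

/-- The only consequence of the parabolic relation that is used afterwards; the cocycle argument
shows that it loses nothing. -/
theorem symbLevel_T_T (g : SL(2, ℤ)) :
    symbLevel Γ (g * T) (g * T * T) = symbLevel Γ g (g * T) := by
  have h := symbLevel_parabolic Γ g 2
  rw [zpow_two, ← mul_assoc, ← symbLevel_add Γ g (g * T), two_zsmul] at h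
  exact add_left_cancel h

/-- The function `Γ g ↦ {g, g h}`. -/
def symbolOf (h : SL(2, ℤ)) : Cosets Γ → SymbolsLevel Γ :=
  liftCosets (fun g => symbLevel Γ g (g * h))
    (fun γ hγ g => by rw [mul_assoc]; exact symbLevel_translate hγ _ _)
    (fun g => by rw [neg_mul, symbLevel_neg_left, symbLevel_neg_right])

/-- The homomorphism `ℤ[Γ \ PSL₂(ℤ)] → M̃_Γ`, `Γ g ↦ {g, g h}`. -/
noncomputable def symbolMap (h : SL(2, ℤ)) : (Cosets Γ →₀ ℤ) →+ SymbolsLevel Γ :=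
  Finsupp.liftAddHom fun x => (zmultiplesHom (SymbolsLevel Γ)) (symbolOf Γ h x)

theorem symbolMap_single (h g : SL(2, ℤ)) :
    symbolMap Γ h (Finsupp.single (coset Γ (toPSL g)) 1) = symbLevel Γ g (g * h) := by
  simp only [symbolMap, Finsupp.liftAddHom_apply_single, zmultiplesHom_apply, one_zsmul]
  rfl

variable {Γ} in
theorem hom_ext_of_single {A : Type*} [AddCommGroup A] {f f' : (Cosets Γ →₀ ℤ) →+ A}
    (h : ∀ g : SL(2, ℤ), f (Finsupp.single (coset Γ (toPSL g)) 1) =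
      f' (Finsupp.single (coset Γ (toPSL g)) 1)) : f = f' := by
  refine Finsupp.addHom_ext' fun x => AddMonoidHom.ext_int ?_
  obtain ⟨g, rfl⟩ := exists_coset_eq Γ x
  exact h g

theorem symbolMap_mul (h h' : SL(2, ℤ)) (a : Cosets Γ →₀ ℤ) :
    symbolMap Γ (h * h') a = symbolMap Γ h a + symbolMap Γ h' (rightMul Γ h a) := by
  refine DFunLike.congr_fun (f := symbolMap Γ (h * h'))
    (g := symbolMap Γ h + (symbolMap Γ h').comp (rightMul Γ h)) (hom_ext_of_single fun g => ?_) a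
  simp only [AddMonoidHom.add_apply, AddMonoidHom.comp_apply, rightMul_single, cosetMul_coset,
    ← map_mul, symbolMap_single]
  rw [← mul_assoc, symbLevel_add]

theorem symbolMap_neg (h : SL(2, ℤ)) : symbolMap Γ (-h) = symbolMap Γ h :=
  hom_ext_of_single fun g => by
    rw [symbolMap_single, symbolMap_single, mul_neg, symbLevel_neg_right]

theorem symbolMap_one : symbolMap Γ 1 = 0 :=
  hom_ext_of_single fun g => by rw [symbolMap_single, mul_one, symbLevel_self]; rfl

theorem symbolMap_T (a : Cosets Γ →₀ ℤ) :
    symbolMap Γ T a = symbolMap Γ U a + symbolMap Γ S (rightMul Γ U a) := by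
  rw [← symbolMap_mul, U_mul_S, symbolMap_neg]

theorem symbolMap_T_rightMul_T (a : Cosets Γ →₀ ℤ) :
    symbolMap Γ T (rightMul Γ T a) = symbolMap Γ T a := by
  refine DFunLike.congr_fun (f := (symbolMap Γ T).comp (rightMul Γ T))
    (hom_ext_of_single fun g => ?_) a
  simp only [AddMonoidHom.comp_apply, rightMul_single, cosetMul_coset, ← map_mul,
    symbolMap_single, symbLevel_T_T]

/-- From {g, gS} + {gS, gS²} = 0 the image of an S-invariant element is killed by 2, and M̃_Γ is
torsion-free. The same argument works for U with 3. -/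
theorem symbolMap_S_eq_zero {a : Cosets Γ →₀ ℤ} (ha : a ∈ fixedBy Γ S) :
    symbolMap Γ S a = 0 := by
  refine SymbolsLevel.eq_zero_of_nsmul Γ two_ne_zero ?_
  have h := symbolMap_mul Γ S S a
  rw [(mem_fixedBy Γ).mp ha, S_mul_S, symbolMap_neg, symbolMap_one] at h
  rw [two_nsmul, ← h]
  rfl

theorem symbolMap_U_eq_zero {a : Cosets Γ →₀ ℤ} (ha : a ∈ fixedBy Γ U) :
    symbolMap Γ U a = 0 := by
  refine SymbolsLevel.eq_zero_of_nsmul Γ three_ne_zero ?_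
  have h := symbolMap_mul Γ (U * U) U a
  rw [U_mul_U_mul_U, symbolMap_neg, symbolMap_one, symbolMap_mul, ← rightMul_rightMul,
    (mem_fixedBy Γ).mp ha, (mem_fixedBy Γ).mp ha] at h
  rw [succ_nsmul, two_nsmul, ← h]
  rfl

theorem exists_symbolMap_add_symbolMap (m : SymbolsLevel Γ) :
    ∃ a b, symbolMap Γ S a + symbolMap Γ U b = m := by
  let B : AddSubgroup (SymbolsLevel Γ) := (symbolMap Γ S).range ⊔ (symbolMap Γ U).range
  suffices h : m ∈ B by
    obtain ⟨_, ⟨a, rfl⟩, _, ⟨b, rfl⟩, h⟩ := AddSubgroup.mem_sup.mp h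
    exact ⟨a, b, h⟩
  -- By the Chasles relation, the h for which every {g, gh} lies in B form a subgroup.
  let H : Subgroup SL(2, ℤ) :=
    { carrier := {h | ∀ g, symbLevel Γ g (g * h) ∈ B}
      one_mem' := fun g => by rw [mul_one, symbLevel_self]; exact B.zero_mem
      mul_mem' := fun {h h'} hh hh' g => by
        rw [← symbLevel_add Γ g (g * h), ← mul_assoc]
        exact B.add_mem (hh g) (hh' _)
      inv_mem' := fun {h} hh g => by
        rw [symbLevel_symm]
        have := hh (g * h⁻¹)
        rw [inv_mul_cancel_right] at this
        exact B.neg_mem this }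
  have hH : ∀ h, h ∈ H := mem_of_S_mem_of_U_mem
    (fun g => AddSubgroup.mem_sup_left ⟨_, symbolMap_single Γ S g⟩)
    (fun g => AddSubgroup.mem_sup_right ⟨_, symbolMap_single Γ U g⟩)
  obtain ⟨x, rfl⟩ := freeToLevel_surjective Γ m
  induction x using FreeAbelianGroup.induction_on with
  | zero => simp
  | of x =>
    change symbLevel Γ x.1 x.2 ∈ B
    simpa using hH (x.1⁻¹ * x.2) x.1
  | neg x h => rw [map_neg]; exact B.neg_mem h
  | add x y hx hy => rw [map_add]; exact B.add_mem hx hy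

end Symbols

/-! ### A presentation of `M̃_Γ` -/

section Presentation

variable (Γ : Subgroup SL(2, ℤ))

/-- The homomorphism `z ↦ ((z T - z) U, z T - z)`. -/
noncomputable def parabolicPair :
    (Cosets Γ →₀ ℤ) →+ (Cosets Γ →₀ ℤ) × (Cosets Γ →₀ ℤ) :=
  ((rightMul Γ U).prod (AddMonoidHom.id _)).comp (rightMul Γ T - AddMonoidHom.id _)

theorem parabolicPair_apply (z : Cosets Γ →₀ ℤ) :
    parabolicPair Γ z = (rightMul Γ U (rightMul Γ T z - z), rightMul Γ T z - z) := rfl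

/-- The group of the pairs `(a, b)` such that the images of `a` under `Γ g ↦ {g, g S}` and of `b`
under `Γ g ↦ {g, g U}` add up to zero in `M̃_Γ`. -/
noncomputable def pairRelations : AddSubgroup ((Cosets Γ →₀ ℤ) × (Cosets Γ →₀ ℤ)) :=
  saturation ((fixedBy Γ S).prod (fixedBy Γ U) ⊔ (parabolicPair Γ).range)

variable {Γ} in
theorem mem_pairRelations {a b : Cosets Γ →₀ ℤ} :
    (a, b) ∈ pairRelations Γ ↔ ∃ n : ℕ, n ≠ 0 ∧ ∃ z : Cosets Γ →₀ ℤ,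
      n • a - rightMul Γ U (rightMul Γ T z - z) ∈ fixedBy Γ S ∧
        n • b - (rightMul Γ T z - z) ∈ fixedBy Γ U := by
  constructor
  · rintro ⟨n, hn, h⟩
    obtain ⟨⟨s, u⟩, ⟨hs, hu⟩, _, ⟨z, rfl⟩, h⟩ := AddSubgroup.mem_sup.mp h
    rw [parabolicPair_apply, Prod.ext_iff] at h
    obtain ⟨h1, h2⟩ := h
    refine ⟨n, hn, z, ?_, ?_⟩
    · rwa [show n • a = _ from h1.symm, Prod.fst_add, add_sub_cancel_right]
    · rwa [show n • b = _ from h2.symm, Prod.snd_add, add_sub_cancel_right]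
  · rintro ⟨n, hn, z, hs, hu⟩
    refine ⟨n, hn, AddSubgroup.mem_sup.mpr ⟨(_, _), ⟨hs, hu⟩, _, ⟨z, rfl⟩, ?_⟩⟩
    rw [parabolicPair_apply]
    simp

/-- The quotient by `pairRelations`, isomorphic to `M̃_Γ`. -/
abbrev PairQuotient : Type :=
  ((Cosets Γ →₀ ℤ) × (Cosets Γ →₀ ℤ)) ⧸ pairRelations Γ

/-- The projection onto `PairQuotient Γ`. -/
noncomputable abbrev toPair :
    ((Cosets Γ →₀ ℤ) × (Cosets Γ →₀ ℤ)) →+ PairQuotient Γ :=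
  QuotientAddGroup.mk' (pairRelations Γ)

theorem toPair_eq_zero_of_mem_fixedBy {a b : Cosets Γ →₀ ℤ} (ha : a ∈ fixedBy Γ S)
    (hb : b ∈ fixedBy Γ U) : toPair Γ (a, b) = 0 :=
  (QuotientAddGroup.eq_zero_iff _).mpr
    (le_saturation _ (AddSubgroup.mem_sup_left (AddSubgroup.mem_prod.mpr ⟨ha, hb⟩)))

/-- A one-cocycle of `PSL₂(ℤ)` with values in the functions on cosets. -/
structure IsCocycle (D : PSL(2, ℤ) → Cosets Γ → PairQuotient Γ) : Prop where
  mul : ∀ h h' x, D (h * h') x = D h x + D h' (cosetMul Γ h x)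
  apply_S : ∀ x, D (toPSL S) x = toPair Γ (Finsupp.single x 1, 0)
  apply_U : ∀ x, D (toPSL U) x = toPair Γ (0, Finsupp.single x 1)

/-- The action of `S` on the extension of the cosets. -/
noncomputable def extS (p : Cosets Γ × PairQuotient Γ) : Cosets Γ × PairQuotient Γ :=
  (cosetMul Γ (toPSL S) p.1, p.2 + toPair Γ (Finsupp.single p.1 1, 0))

/-- The action of `U` on the extension of the cosets. -/
noncomputable def extU (p : Cosets Γ × PairQuotient Γ) : Cosets Γ × PairQuotient Γ :=
  (cosetMul Γ (toPSL U) p.1, p.2 + toPair Γ (0, Finsupp.single p.1 1))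

/-- The translations accumulated along an S-orbit add up to the class of x + xS, which is
S-invariant and so vanishes in the quotient. -/
theorem extS_extS (p : Cosets Γ × PairQuotient Γ) : extS Γ (extS Γ p) = p := by
  obtain ⟨x, q⟩ := p
  have h := toPair_eq_zero_of_mem_fixedBy Γ (add_rightMul_S_mem_fixedBy Γ (Finsupp.single x 1))
    (fixedBy Γ U).zero_mem
  rw [rightMul_single, ← add_zero (0 : Cosets Γ →₀ ℤ), ← Prod.mk_add_mk, map_add] at h
  refine Prod.ext ?_ ?_
  · change cosetMul Γ _ (cosetMul Γ _ x) = x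
    rw [cosetMul_cosetMul, ← pow_two, toPSL_S_sq, cosetMul_one]
  · change q + toPair Γ (Finsupp.single x 1, 0) +
      toPair Γ (Finsupp.single (cosetMul Γ (toPSL S) x) 1, 0) = q
    rw [add_assoc, h, add_zero]

theorem extU_extU_extU (p : Cosets Γ × PairQuotient Γ) :
    extU Γ (extU Γ (extU Γ p)) = p := by
  obtain ⟨x, q⟩ := p
  have h := toPair_eq_zero_of_mem_fixedBy Γ (fixedBy Γ S).zero_mem
    (add_rightMul_U_mem_fixedBy Γ (Finsupp.single x 1))
  rw [rightMul_single, rightMul_single, ← add_zero (0 : Cosets Γ →₀ ℤ),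
    ← add_zero (0 + 0 : Cosets Γ →₀ ℤ), ← Prod.mk_add_mk, ← Prod.mk_add_mk, map_add, map_add] at h
  refine Prod.ext ?_ ?_
  · change cosetMul Γ _ (cosetMul Γ _ (cosetMul Γ _ x)) = x
    rw [cosetMul_cosetMul, cosetMul_cosetMul, ← pow_two, ← pow_succ', toPSL_U_cube, cosetMul_one]
  · change q + toPair Γ (0, Finsupp.single x 1) +
      toPair Γ (0, Finsupp.single (cosetMul Γ (toPSL U) x) 1) +
      toPair Γ (0, Finsupp.single (cosetMul Γ (toPSL U) (cosetMul Γ (toPSL U) x)) 1) = q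
    rw [add_assoc, add_assoc, ← add_assoc (toPair Γ _), h, add_zero]

/-- The involution `extS` and the order 3 permutation `extU` define an action of the free product
PSL₂(ℤ) on the product of X with the quotient. The displacement in the second coordinate is the
cocycle. -/
theorem exists_isCocycle : ∃ D, IsCocycle Γ D := by
  let s : Equiv.Perm (Cosets Γ × PairQuotient Γ) := ⟨extS Γ, extS Γ, extS_extS Γ, extS_extS Γ⟩
  let u : Equiv.Perm (Cosets Γ × PairQuotient Γ) :=
    ⟨extU Γ, fun p => extU Γ (extU Γ p), extU_extU_extU Γ, extU_extU_extU Γ⟩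
  -- The action is on the right, hence the opposite group.
  obtain ⟨θ, hθS, hθU⟩ := exists_hom_of_sq_eq_one_of_cube_eq_one
    (MulOpposite.op s) (MulOpposite.op u)
    (by rw [← MulOpposite.op_pow, pow_two]
        exact congrArg _ (Equiv.ext (extS_extS Γ)))
    (by rw [← MulOpposite.op_pow, pow_succ, pow_two]
        exact congrArg _ (Equiv.ext (extU_extU_extU Γ)))
  let act (h : PSL(2, ℤ)) : Equiv.Perm (Cosets Γ × PairQuotient Γ) := (θ h).unop
  have act_mul (h h' : PSL(2, ℤ)) (p) : act (h * h') p = act h' (act h p) := by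
    simp [act]
  have act_one (p) : act 1 p = p := by simp [act]
  have act_S (p) : act (toPSL S) p = extS Γ p := by simp only [act, hθS]; rfl
  have act_U (p) : act (toPSL U) p = extU Γ p := by simp only [act, hθU]; rfl
  -- The elements whose action commutes with translations of the second coordinate; for these the
  -- displacement depends on the coset alone.
  let H : Subgroup SL(2, ℤ) :=
    { carrier := {h | ∀ x q, act (toPSL h) (x, q) =
        (cosetMul Γ (toPSL h) x, q + (act (toPSL h) (x, 0)).2)}
      one_mem' := fun x q => by simp [act_one]
      mul_mem' := fun {h h'} hh hh' x q => by
        rw [map_mul, act_mul, act_mul, hh x q, hh', hh x 0, hh' _ (0 + _), cosetMul_cosetMul]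
        simp [add_assoc]
      inv_mem' := fun {h} hh x q => by
        have key : ∀ q, act (toPSL h⁻¹) (x, q) = (cosetMul Γ (toPSL h⁻¹) x,
            q - (act (toPSL h) (cosetMul Γ (toPSL h⁻¹) x, 0)).2) := fun q => by
          apply (act (toPSL h)).injective
          rw [← act_mul, ← map_mul, inv_mul_cancel, map_one, act_one, hh, cosetMul_cosetMul,
            ← map_mul, inv_mul_cancel, map_one, cosetMul_one, sub_add_cancel]
        rw [key, key 0]
        simp [sub_eq_add_neg] }
  have hH : ∀ h, h ∈ H := mem_of_S_mem_of_U_mem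
    (fun x q => by rw [act_S, act_S]; simp [extS])
    (fun x q => by rw [act_U, act_U]; simp [extU])
  have key : ∀ (h : PSL(2, ℤ)) x q, act h (x, q) = (cosetMul Γ h x, q + (act h (x, 0)).2) := by
    intro h
    obtain ⟨h, rfl⟩ := QuotientGroup.mk'_surjective _ h
    exact hH h
  refine ⟨fun h x => (act h (x, 0)).2, fun h h' x => ?_, fun x => ?_, fun x => ?_⟩
  · rw [act_mul, key h x 0, key h' _ (0 + _), zero_add]
  · rw [act_S]; simp [extS]
  · rw [act_U]; simp [extU]

/-! ### Maps out of M̃_Γ attached to a cocycle -/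

variable {Γ}

namespace IsCocycle

variable {D : PSL(2, ℤ) → Cosets Γ → PairQuotient Γ}

theorem apply_one (hD : IsCocycle Γ D) (x : Cosets Γ) : D 1 x = 0 := by
  have h := hD.mul 1 1 x
  rwa [mul_one, cosetMul_one, left_eq_add] at h

theorem apply_T (hD : IsCocycle Γ D) (x : Cosets Γ) : D (toPSL T) x =
    toPair Γ (rightMul Γ U (Finsupp.single x 1), Finsupp.single x 1) := by
  rw [toPSL_T, hD.mul, hD.apply_S, hD.apply_U, ← map_add, rightMul_single]
  simp

/-- The value at T is constant along T-orbits because the pairs ((zT − z)U, zT − z) were put in the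
relations; hence the value at Tⁿ is n times the value at T. -/
theorem apply_T_cosetMul_T (hD : IsCocycle Γ D) (x : Cosets Γ) :
    D (toPSL T) (cosetMul Γ (toPSL T) x) = D (toPSL T) x := by
  rw [hD.apply_T, hD.apply_T, ← sub_eq_zero, ← map_sub]
  refine (QuotientAddGroup.eq_zero_iff _).mpr
    (le_saturation _ (AddSubgroup.mem_sup_right ⟨Finsupp.single x 1, ?_⟩))
  rw [parabolicPair_apply, rightMul_single, map_sub]
  rfl

theorem apply_T_cosetMul_T_zpow (hD : IsCocycle Γ D) (x : Cosets Γ) (n : ℤ) :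
    D (toPSL T) (cosetMul Γ (toPSL T ^ n) x) = D (toPSL T) x := by
  induction n using Int.induction_on with
  | zero => simp
  | succ n ih => rw [zpow_add_one, ← cosetMul_cosetMul, hD.apply_T_cosetMul_T, ih]
  | pred n ih =>
    rw [← ih, ← hD.apply_T_cosetMul_T, cosetMul_cosetMul, ← zpow_add_one, sub_add_cancel]

theorem apply_T_zpow (hD : IsCocycle Γ D) (x : Cosets Γ) (n : ℤ) :
    D (toPSL T ^ n) x = n • D (toPSL T) x := by
  induction n using Int.induction_on with
  | zero => simp [hD.apply_one]
  | succ n ih => rw [zpow_add_one, hD.mul, hD.apply_T_cosetMul_T_zpow, ih, add_zsmul, one_zsmul]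
  | pred n ih =>
    have h := hD.mul (toPSL T ^ (-n - 1 : ℤ)) (toPSL T) x
    rw [← zpow_add_one, sub_add_cancel, hD.apply_T_cosetMul_T_zpow, ih] at h
    rw [sub_zsmul, one_zsmul, h, add_neg_cancel_right]

/-- The map on the free group of pairs defined by a cocycle. -/
noncomputable def freeHom (_ : IsCocycle Γ D) :
    FreeAbelianGroup (SL(2, ℤ) × SL(2, ℤ)) →+ PairQuotient Γ :=
  FreeAbelianGroup.lift fun p => D ((toPSL p.1)⁻¹ * toPSL p.2) (coset Γ (toPSL p.1))

theorem freeHom_gen (hD : IsCocycle Γ D) (g g' : SL(2, ℤ)) :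
    hD.freeHom (gen g g') = D ((toPSL g)⁻¹ * toPSL g') (coset Γ (toPSL g)) := by
  simp [freeHom, gen]

theorem freeHom_add (hD : IsCocycle Γ D) (g g' g'' : SL(2, ℤ)) :
    hD.freeHom (gen g g') + hD.freeHom (gen g' g'') = hD.freeHom (gen g g'') := by
  rw [freeHom_gen, freeHom_gen, freeHom_gen,
    show (toPSL g)⁻¹ * toPSL g'' = ((toPSL g)⁻¹ * toPSL g') * ((toPSL g')⁻¹ * toPSL g'') by group,
    hD.mul ((toPSL g)⁻¹ * toPSL g'), cosetMul_coset, mul_inv_cancel_left]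

theorem freeHom_eq_zero (hD : IsCocycle Γ D)
    {x : FreeAbelianGroup (SL(2, ℤ) × SL(2, ℤ))} (hx : IsRelation x) :
    hD.freeHom x = 0 := by
  cases hx with
  | chasles g g' g'' =>
    rw [map_add, map_add, freeHom_add, freeHom_add, freeHom_gen, inv_mul_cancel, hD.apply_one]
  | sign g g' ε₁ ε₂ h₁ h₂ =>
    have key : ∀ ε h : SL(2, ℤ), (ε = 1 ∨ ε = -1) → toPSL (ε * h) = toPSL h := by
      rintro ε h (rfl | rfl)
      · rw [one_mul]
      · rw [neg_one_mul, toPSL_neg]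
    rw [map_sub, freeHom_gen, freeHom_gen, key _ _ h₁, key _ _ h₂, sub_self]
  | parabolic g n =>
    rw [map_sub, map_zsmul, freeHom_gen, freeHom_gen, map_mul, map_mul, inv_mul_cancel_left,
      inv_mul_cancel_left, map_zpow, hD.apply_T_zpow, sub_self]

theorem freeHom_freeTranslate (hD : IsCocycle Γ D) {γ : SL(2, ℤ)} (hγ : γ ∈ Γ)
    (x : FreeAbelianGroup (SL(2, ℤ) × SL(2, ℤ))) :
    hD.freeHom (freeTranslate γ x) = hD.freeHom x := by
  refine DFunLike.congr_fun (f := hD.freeHom.comp (freeTranslate γ)) ?_ x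
  refine FreeAbelianGroup.lift_ext _ _ fun p => ?_
  change hD.freeHom (freeTranslate γ (gen p.1 p.2)) = hD.freeHom (gen p.1 p.2)
  rw [freeTranslate_gen, freeHom_gen, freeHom_gen, map_mul, map_mul, coset_mul_left Γ hγ]
  group

theorem relations_le_ker (hD : IsCocycle Γ D) : relations ≤ hD.freeHom.ker := by
  refine saturation_le_ker _
    (fun n b hn h => eq_zero_of_nsmul_eq_zero_quotient_saturation hn h) ?_
  rw [AddSubgroup.closure_le]
  exact fun x hx => hD.freeHom_eq_zero hx

/-- The map on `M̃` defined by a cocycle. -/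
noncomputable def symbolsHom (hD : IsCocycle Γ D) : Symbols →+ PairQuotient Γ :=
  QuotientAddGroup.lift relations hD.freeHom hD.relations_le_ker

theorem coinvariantRelations_le_ker (hD : IsCocycle Γ D) :
    coinvariantRelations Γ ≤ hD.symbolsHom.ker := by
  refine saturation_le_ker _
    (fun n b hn h => eq_zero_of_nsmul_eq_zero_quotient_saturation hn h) ?_
  rw [AddSubgroup.closure_le]
  rintro _ ⟨γ, hγ, m, rfl⟩
  rw [SetLike.mem_coe, AddMonoidHom.mem_ker, map_sub, sub_eq_zero]
  obtain ⟨x, rfl⟩ := QuotientAddGroup.mk'_surjective relations m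
  exact hD.freeHom_freeTranslate hγ x

/-- The map on `M̃_Γ` defined by a cocycle. -/
noncomputable def levelHom (hD : IsCocycle Γ D) : SymbolsLevel Γ →+ PairQuotient Γ :=
  QuotientAddGroup.lift (coinvariantRelations Γ) hD.symbolsHom hD.coinvariantRelations_le_ker

theorem levelHom_symbLevel (hD : IsCocycle Γ D) (g h : SL(2, ℤ)) :
    hD.levelHom (symbLevel Γ g (g * h)) = D (toPSL h) (coset Γ (toPSL g)) := by
  change hD.freeHom (gen g (g * h)) = _
  rw [freeHom_gen, map_mul, inv_mul_cancel_left]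

theorem levelHom_symbolMap_S (hD : IsCocycle Γ D) (a : Cosets Γ →₀ ℤ) :
    hD.levelHom (symbolMap Γ S a) = toPair Γ (a, 0) := by
  refine DFunLike.congr_fun (f := hD.levelHom.comp (symbolMap Γ S))
    (g := (toPair Γ).comp (AddMonoidHom.inl _ _)) (hom_ext_of_single fun g => ?_) a
  rw [AddMonoidHom.comp_apply, symbolMap_single, levelHom_symbLevel, hD.apply_S]
  rfl

theorem levelHom_symbolMap_U (hD : IsCocycle Γ D) (a : Cosets Γ →₀ ℤ) :
    hD.levelHom (symbolMap Γ U a) = toPair Γ (0, a) := by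
  refine DFunLike.congr_fun (f := hD.levelHom.comp (symbolMap Γ U))
    (g := (toPair Γ).comp (AddMonoidHom.inr _ _)) (hom_ext_of_single fun g => ?_) a
  rw [AddMonoidHom.comp_apply, symbolMap_single, levelHom_symbLevel, hD.apply_U]
  rfl

end IsCocycle

/-- The presentation of M̃_Γ. A cocycle separates the classes of pairs; conversely, modulo
invariants and after multiplication by n, the sum is the image of zT − z under {g, gT}, which is
zero. -/
theorem symbolMap_add_eq_zero_iff (a b : Cosets Γ →₀ ℤ) :
    symbolMap Γ S a + symbolMap Γ U b = 0 ↔ (a, b) ∈ pairRelations Γ := by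
  constructor
  · intro h
    obtain ⟨D, hD⟩ := exists_isCocycle Γ
    have h' := congrArg hD.levelHom h
    rw [map_add, hD.levelHom_symbolMap_S, hD.levelHom_symbolMap_U, ← map_add, map_zero] at h'
    simpa using (QuotientAddGroup.eq_zero_iff _).mp h'
  · intro h
    obtain ⟨n, hn, z, hs, hu⟩ := mem_pairRelations.mp h
    refine SymbolsLevel.eq_zero_of_nsmul Γ hn ?_
    have h1 := symbolMap_S_eq_zero Γ hs
    have h2 := symbolMap_U_eq_zero Γ hu
    rw [map_sub, sub_eq_zero, map_nsmul] at h1 h2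
    rw [smul_add, h1, h2, add_comm, ← symbolMap_T, map_sub, symbolMap_T_rightMul_T, sub_self]

end Presentation

/-! ### Cusps and widths -/

section Cusps

variable (Γ : Subgroup SL(2, ℤ))

instance finite_cosets [Γ.FiniteIndex] : Finite (Cosets Γ) := by
  refine Finite.of_surjective
    (fun x : SL(2, ℤ) ⧸ Γ => Quotient.lift (fun g => coset Γ (toPSL g⁻¹)) ?_ x) ?_
  · intro a b hab
    have h := QuotientGroup.leftRel_apply.mp hab
    refine (coset_eq_iff Γ).mpr (.inl ?_)
    simpa using Γ.inv_mem h
  · intro c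
    obtain ⟨g, rfl⟩ := exists_coset_eq Γ c
    exact ⟨QuotientGroup.mk g⁻¹, congrArg (fun g => coset Γ (toPSL g)) (inv_inv g)⟩

theorem exists_eq_T_zpow_of_entry_eq_zero {g : SL(2, ℤ)} (h : g 1 0 = 0) :
    ∃ n : ℤ, g = T ^ n ∨ g = -T ^ n := by
  have hdet := g.det_coe
  rw [Matrix.det_fin_two, h, mul_zero, sub_zero] at hdet
  rcases Int.eq_one_or_neg_one_of_mul_eq_one' hdet with ⟨h0, h1⟩ | ⟨h0, h1⟩
  · refine ⟨g 0 1, .inl ?_⟩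
    ext i j
    fin_cases i <;> fin_cases j <;> simp [coe_T_zpow, h, h0, h1]
  · refine ⟨-g 0 1, .inr ?_⟩
    ext i j
    fin_cases i <;> fin_cases j <;> simp [coe_T_zpow, h, h0, h1]

theorem mapGL_T_zpow_smul_infty (n : ℤ) :
    Matrix.SpecialLinearGroup.mapGL ℚ (T ^ n) • (OnePoint.infty : OnePoint ℚ) =
      OnePoint.infty := by
  rw [OnePoint.smul_infty_eq_self_iff]
  simp [coe_T_zpow, -map_zpow]

theorem cusp_mul_T_zpow (g : SL(2, ℤ)) (n : ℤ) : cusp Γ (g * T ^ n) = cusp Γ g := by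
  rw [cusp, map_mul, mul_smul, mapGL_T_zpow_smul_infty, cusp]

/-- The stabilizer of ∞ in SL₂(ℤ) consists of the ±Tⁿ. -/
theorem cusp_eq_iff {g h : SL(2, ℤ)} :
    cusp Γ g = cusp Γ h ↔ ∃ n : ℤ, coset Γ (toPSL (g * T ^ n)) = coset Γ (toPSL h) := by
  constructor
  · intro e
    obtain ⟨⟨_, γ, hγ, rfl⟩, e⟩ := Quotient.exact e
    change Matrix.SpecialLinearGroup.mapGL ℚ γ • Matrix.SpecialLinearGroup.mapGL ℚ h •
      (OnePoint.infty : OnePoint ℚ) = Matrix.SpecialLinearGroup.mapGL ℚ g • OnePoint.infty at e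
    rw [← mul_smul, ← map_mul, ← inv_smul_eq_iff, ← mul_smul, ← map_inv, ← map_mul,
      OnePoint.smul_infty_eq_self_iff] at e
    have key : ∀ k : SL(2, ℤ), Matrix.SpecialLinearGroup.mapGL ℚ k 1 0 = 0 → k 1 0 = 0 := by
      intro k hk
      simpa using hk
    obtain ⟨n, hn⟩ := exists_eq_T_zpow_of_entry_eq_zero (key _ e)
    refine ⟨n, ?_⟩
    have hn' : toPSL (g⁻¹ * (γ * h)) = toPSL (T ^ n) := toPSL_eq_iff.mpr hn
    rw [map_mul, ← hn', ← map_mul, mul_inv_cancel_left, map_mul, coset_mul_left Γ hγ]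
  · rintro ⟨n, e⟩
    have h' := congrArg (cosetCusp Γ) e
    rwa [cosetCusp, liftCosets_coset, liftCosets_coset, cusp_mul_T_zpow] at h'

theorem cosetCusp_coset (g : SL(2, ℤ)) : cosetCusp Γ (coset Γ (toPSL g)) = cusp Γ g := rfl

theorem cosetCusp_surjective : Function.Surjective (cosetCusp Γ) := fun c => by
  obtain ⟨g, rfl⟩ := cusp_surjective Γ c
  exact ⟨_, cosetCusp_coset Γ g⟩

theorem cosetPerm_zpow_apply (h : PSL(2, ℤ)) (n : ℤ) (x : Cosets Γ) :
    (cosetPerm Γ h ^ n) x = cosetMul Γ (h ^ n) x := by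
  induction n using Int.induction_on generalizing x with
  | zero => simp
  | succ n ih =>
    rw [zpow_add_one, Equiv.Perm.mul_apply, ih]
    change cosetMul Γ _ (cosetMul Γ h x) = _
    rw [cosetMul_cosetMul, ← zpow_one_add, add_comm]
  | pred n ih =>
    rw [zpow_sub_one, Equiv.Perm.mul_apply, ih]
    change cosetMul Γ _ (cosetMul Γ h⁻¹ x) = _
    rw [cosetMul_cosetMul, ← zpow_neg_one, ← zpow_add, neg_add_eq_sub, sub_eq_neg_add,
      neg_add_eq_sub]

theorem cosetCusp_eq_iff {x y : Cosets Γ} :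
    cosetCusp Γ x = cosetCusp Γ y ↔ ∃ n : ℤ, (cosetPerm Γ (toPSL T) ^ n) x = y := by
  obtain ⟨g, rfl⟩ := exists_coset_eq Γ x
  obtain ⟨h, rfl⟩ := exists_coset_eq Γ y
  rw [cosetCusp_coset, cosetCusp_coset, cusp_eq_iff]
  simp only [cosetPerm_zpow_apply, cosetMul_coset, map_mul, map_zpow]

/-! ### T-orbits of cosets, and widths as their lengths -/

theorem isPeriodicPt_iff (g : SL(2, ℤ)) (n : ℕ) :
    Function.IsPeriodicPt (cosetPerm Γ (toPSL T)) n (coset Γ (toPSL g)) ↔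
      g * T ^ n * g⁻¹ ∈ Γ ∨ -(g * T ^ n * g⁻¹) ∈ Γ := by
  rw [← coset_eq_iff, Function.IsPeriodicPt, Function.IsFixedPt, ← Equiv.Perm.coe_pow,
    ← zpow_natCast, cosetPerm_zpow_apply, cosetMul_coset, map_mul, map_pow, zpow_natCast, eq_comm]

theorem isPeriodicPt_iff_of_cosetCusp_eq {x y : Cosets Γ} (h : cosetCusp Γ x = cosetCusp Γ y)
    (n : ℕ) : Function.IsPeriodicPt (cosetPerm Γ (toPSL T)) n x ↔
      Function.IsPeriodicPt (cosetPerm Γ (toPSL T)) n y := by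
  obtain ⟨m, rfl⟩ := (cosetCusp_eq_iff Γ).mp h
  simp only [Function.IsPeriodicPt, Function.IsFixedPt, ← Equiv.Perm.coe_pow]
  rw [← Equiv.Perm.mul_apply, ← zpow_natCast, ← zpow_add, add_comm, zpow_add,
    Equiv.Perm.mul_apply, EmbeddingLike.apply_eq_iff_eq]

/-- The homomorphism `ℤ[Γ \ PSL₂(ℤ)] → ℤ[C_Γ]`, `Γ g ↦ [Γ g ∞]`. -/
noncomputable def freeCuspMap : (Cosets Γ →₀ ℤ) →+ (Cusps Γ →₀ ℤ) :=
  Finsupp.mapDomain.addMonoidHom (cosetCusp Γ)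

theorem freeCuspMap_single (x : Cosets Γ) (n : ℤ) :
    freeCuspMap Γ (Finsupp.single x n) = Finsupp.single (cosetCusp Γ x) n :=
  Finsupp.mapDomain_single

/-- Modulo the image of T − 1, each coset equals a chosen representative σ of its T-orbit, so the
projection factors through ℤ[C_Γ]. -/
theorem exists_eq_of_freeCuspMap_eq_zero {y : Cosets Γ →₀ ℤ} (hy : freeCuspMap Γ y = 0) :
    ∃ z, y = rightMul Γ T z - z := by
  let δ : (Cosets Γ →₀ ℤ) →+ (Cosets Γ →₀ ℤ) := rightMul Γ T - AddMonoidHom.id _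
  let q := QuotientAddGroup.mk' δ.range
  let σ := Function.surjInv (cosetCusp_surjective Γ)
  have hT : ∀ a, q (rightMul Γ T a) = q a := fun a => by
    rw [← sub_eq_zero, ← map_sub]
    exact (QuotientAddGroup.eq_zero_iff _).mpr ⟨a, rfl⟩
  have hTn : ∀ (n : ℤ) x, q (Finsupp.single ((cosetPerm Γ (toPSL T) ^ n) x) 1) =
      q (Finsupp.single x 1) := fun n x => by
    have h1 : ∀ x, q (Finsupp.single (cosetPerm Γ (toPSL T) x) 1) = q (Finsupp.single x 1) :=
      fun x => by rw [← hT (Finsupp.single x 1), rightMul_single]; rfl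
    induction n using Int.induction_on with
    | zero => simp
    | succ n ih => rw [add_comm, zpow_one_add, Equiv.Perm.mul_apply, h1, ih]
    | pred n ih => rw [← ih, ← h1, ← Equiv.Perm.mul_apply, ← zpow_one_add, add_sub_cancel]
  have hq : q = q.comp ((Finsupp.mapDomain.addMonoidHom σ).comp (freeCuspMap Γ)) := by
    refine hom_ext_of_single fun g => ?_
    rw [AddMonoidHom.comp_apply, AddMonoidHom.comp_apply, freeCuspMap_single]
    simp only [Finsupp.mapDomain.addMonoidHom_apply, Finsupp.mapDomain_single]
    obtain ⟨n, hn⟩ := (cosetCusp_eq_iff Γ).mp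
      (Function.surjInv_eq (cosetCusp_surjective Γ) (cosetCusp Γ (coset Γ (toPSL g)))).symm
    rw [show σ _ = _ from hn.symm, hTn]
  have h0 : q y = 0 := by
    rw [hq, AddMonoidHom.comp_apply, AddMonoidHom.comp_apply, hy, map_zero, map_zero]
  obtain ⟨z, hz⟩ := (QuotientAddGroup.eq_zero_iff y).mp h0
  exact ⟨z, hz.symm⟩

theorem freeCuspMap_rightMul_T (z : Cosets Γ →₀ ℤ) :
    freeCuspMap Γ (rightMul Γ T z) = freeCuspMap Γ z := by
  refine DFunLike.congr_fun (f := (freeCuspMap Γ).comp (rightMul Γ T))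
    (hom_ext_of_single fun g => ?_) z
  rw [AddMonoidHom.comp_apply, rightMul_single, freeCuspMap_single, freeCuspMap_single,
    cosetMul_coset, ← map_mul, cosetCusp_coset, cosetCusp_coset]
  congr 1
  simpa using cusp_mul_T_zpow Γ g 1

theorem width_eq_minimalPeriod [Γ.FiniteIndex] (x : Cosets Γ) :
    width Γ (cosetCusp Γ x) = Function.minimalPeriod (cosetPerm Γ (toPSL T)) x := by
  obtain ⟨g, rfl⟩ := exists_coset_eq Γ x
  have hpos : 0 < Function.minimalPeriod (cosetPerm Γ (toPSL T)) (coset Γ (toPSL g)) :=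
    Function.minimalPeriod_pos_of_mem_periodicPts
      ((cosetPerm Γ (toPSL T)).injective.mem_periodicPts _)
  have hmem : Function.minimalPeriod (cosetPerm Γ (toPSL T)) (coset Γ (toPSL g)) ∈
      {h | 0 < h ∧ ∃ g' : SL(2, ℤ), cusp Γ g' = cusp Γ g ∧
        (g' * T ^ h * g'⁻¹ ∈ Γ ∨ -(g' * T ^ h * g'⁻¹) ∈ Γ)} :=
    ⟨hpos, g, rfl, (isPeriodicPt_iff Γ _ _).mp (Function.isPeriodicPt_minimalPeriod _ _)⟩
  -- The infimum runs over all g above the cusp, but points of one T-orbit have the same periods.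
  refine le_antisymm (Nat.sInf_le hmem) (le_csInf ⟨_, hmem⟩ ?_)
  rintro n ⟨hn, g', hg', h⟩
  refine Function.IsPeriodicPt.minimalPeriod_le hn ?_
  rw [← isPeriodicPt_iff_of_cosetCusp_eq Γ (x := coset Γ (toPSL g')) hg']
  exact (isPeriodicPt_iff Γ _ _).mpr h

theorem width_eq_card [Γ.FiniteIndex] (c : Cusps Γ) :
    width Γ c = Nat.card {x // cosetCusp Γ x = c} := by
  obtain ⟨x, rfl⟩ := cosetCusp_surjective Γ c
  rw [width_eq_minimalPeriod]
  have := Fintype.ofFinite (MulAction.orbit (Subgroup.zpowers (cosetPerm Γ (toPSL T))) x)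
  have h := MulAction.minimalPeriod_eq_card (cosetPerm Γ (toPSL T)) x
  rw [← Nat.card_eq_fintype_card] at h
  refine h.trans (Nat.card_congr (Equiv.subtypeEquivRight fun y => ?_))
  rw [eq_comm, cosetCusp_eq_iff, MulAction.mem_orbit_iff]
  constructor
  · rintro ⟨⟨_, n, rfl⟩, h⟩
    exact ⟨n, h⟩
  · rintro ⟨n, h⟩
    exact ⟨⟨_, n, rfl⟩, h⟩

theorem width_pos [Γ.FiniteIndex] (c : Cusps Γ) : 0 < width Γ c := by
  rw [width_eq_card]
  obtain ⟨x, hx⟩ := cosetCusp_surjective Γ c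
  have : Nonempty {x // cosetCusp Γ x = c} := ⟨⟨x, hx⟩⟩
  exact Nat.card_pos

variable [Γ.FiniteIndex]

theorem widthGcd_dvd (c : Cusps Γ) : widthGcd Γ ∣ width Γ c := by
  let _ := Fintype.ofFinite (Cusps Γ)
  exact Finset.gcd_dvd (Finset.mem_univ c)

theorem dvd_widthGcd_mul {n k : ℕ} (h : ∀ c, n ∣ k * width Γ c) : n ∣ k * widthGcd Γ := by
  let _ := Fintype.ofFinite (Cusps Γ)
  have : n ∣ Finset.univ.gcd fun c => k * width Γ c := Finset.dvd_gcd fun c _ => h c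
  rwa [Finset.gcd_mul_left, normalize_eq] at this

theorem widthGcd_ne_zero : widthGcd Γ ≠ 0 := fun h => by
  have := widthGcd_dvd Γ (cusp Γ 1)
  rw [h, zero_dvd_iff] at this
  exact (width_pos Γ _).ne' this

/-- The sum of all the cosets. -/
noncomputable def cosetSum : Cosets Γ →₀ ℤ := Finsupp.equivFunOnFinite.symm fun _ => 1

@[simp]
theorem cosetSum_apply (x : Cosets Γ) : cosetSum Γ x = 1 := rfl

theorem rightMul_cosetSum (h : SL(2, ℤ)) : rightMul Γ h (cosetSum Γ) = cosetSum Γ := by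
  ext x
  obtain ⟨y, rfl⟩ := (cosetPerm Γ (toPSL h)).surjective x
  exact rightMul_apply Γ h _ y

theorem cosetSum_mem_fixedBy (h : SL(2, ℤ)) : cosetSum Γ ∈ fixedBy Γ h :=
  rightMul_cosetSum Γ h

theorem freeCuspMap_cosetSum_apply (c : Cusps Γ) :
    freeCuspMap Γ (cosetSum Γ) c = width Γ c := by
  classical
  let _ := Fintype.ofFinite (Cosets Γ)
  have h : cosetSum Γ = ∑ x, Finsupp.single x 1 := by
    ext x
    simp [Finsupp.finsetSum_apply, Finsupp.single_apply]
  rw [h, map_sum, Finsupp.finsetSum_apply, width_eq_card, Nat.card_eq_fintype_card,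
    Fintype.card_subtype]
  simp [freeCuspMap_single, Finsupp.single_apply]

theorem freeCuspMap_cosetSum :
    freeCuspMap Γ (cosetSum Γ) = widthGcd Γ • widthElement Γ := by
  ext c
  rw [freeCuspMap_cosetSum_apply]
  change _ = widthGcd Γ • ((width Γ c / widthGcd Γ : ℕ) : ℤ)
  rw [nsmul_eq_mul, ← Nat.cast_mul, Nat.mul_div_cancel' (widthGcd_dvd Γ c)]

/-! ### The kernel of φ_Γ -/

theorem cuspMap_apply (a : Cosets Γ →₀ ℤ) :
    cuspMap Γ a = toCuspQuotient Γ (freeCuspMap Γ a) := by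
  refine DFunLike.congr_fun (g := (toCuspQuotient Γ).comp (freeCuspMap Γ))
    (hom_ext_of_single fun g => ?_) a
  rw [cuspMap, Finsupp.liftAddHom_apply_single, zmultiplesHom_apply, one_zsmul,
    AddMonoidHom.comp_apply, freeCuspMap_single]
  rfl

theorem cuspMap_single (g : SL(2, ℤ)) :
    cuspMap Γ (Finsupp.single (coset Γ (toPSL g)) 1) = cuspClass Γ (cusp Γ g) := by
  rw [cuspMap_apply, freeCuspMap_single]
  rfl

theorem toCuspQuotient_surjective : Function.Surjective (toCuspQuotient Γ) :=
  QuotientAddGroup.mk'_surjective _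

theorem cuspMap_surjective : Function.Surjective (cuspMap Γ) := fun y => by
  obtain ⟨y, rfl⟩ := toCuspQuotient_surjective Γ y
  obtain ⟨a, rfl⟩ := Finsupp.mapDomain_surjective (cosetCusp_surjective Γ) y
  exact ⟨a, cuspMap_apply Γ a⟩

theorem toCuspQuotient_eq_zero_iff {y : Cusps Γ →₀ ℤ} :
    toCuspQuotient Γ y = 0 ↔ ∃ m : ℤ, m • widthElement Γ = y :=
  (QuotientAddGroup.eq_zero_iff y).trans AddSubgroup.mem_zmultiples_iff

/-- If a maps to m times the width element, then d_Γ a and mΣ have the same image in ℤ[C_Γ]. -/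
theorem exists_of_cuspMap_eq_zero {a : Cosets Γ →₀ ℤ} (ha : cuspMap Γ a = 0) :
    ∃ (m : ℤ) (z : Cosets Γ →₀ ℤ),
      widthGcd Γ • a = m • cosetSum Γ + (rightMul Γ T z - z) := by
  rw [cuspMap_apply, toCuspQuotient_eq_zero_iff] at ha
  obtain ⟨m, hm⟩ := ha
  obtain ⟨z, hz⟩ := exists_eq_of_freeCuspMap_eq_zero Γ
    (y := widthGcd Γ • a - m • cosetSum Γ) (by
      rw [map_sub, map_nsmul, map_zsmul, freeCuspMap_cosetSum, ← hm, smul_comm, sub_self])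
  exact ⟨m, z, by rw [← hz, add_sub_cancel]⟩

/-- Comparing coefficients, n divides k e_c for every c, hence k d_Γ; so a maps to k d_Γ / n times
the width element. -/
theorem cuspMap_eq_zero_of_nsmul {n : ℕ} (hn : n ≠ 0) {k : ℤ} {a : Cosets Γ →₀ ℤ}
    (h : n • freeCuspMap Γ a = k • freeCuspMap Γ (cosetSum Γ)) : cuspMap Γ a = 0 := by
  have hc : ∀ c, (n : ℤ) * freeCuspMap Γ a c = k * width Γ c := fun c => by
    have := DFunLike.congr_fun h c
    simpa [freeCuspMap_cosetSum_apply] using this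
  have hd : (n : ℤ) ∣ k * widthGcd Γ := by
    rw [Int.natCast_dvd, Int.natAbs_mul, Int.natAbs_natCast]
    refine dvd_widthGcd_mul Γ fun c => ?_
    have : (n : ℤ) ∣ k * width Γ c := ⟨_, (hc c).symm⟩
    rwa [Int.natCast_dvd, Int.natAbs_mul, Int.natAbs_natCast] at this
  obtain ⟨j, hj⟩ := hd
  rw [cuspMap_apply, toCuspQuotient_eq_zero_iff]
  refine ⟨j, nsmul_right_injective hn ?_⟩
  change n • j • widthElement Γ = n • freeCuspMap Γ a
  rw [h, freeCuspMap_cosetSum, ← natCast_zsmul, ← natCast_zsmul, smul_smul, smul_smul, hj]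

/-- An element invariant under `S` and `U` modulo `n` is constant modulo `n`. -/
theorem exists_eq_zsmul_cosetSum_add {n : ℕ} {y s u : Cosets Γ →₀ ℤ}
    (hS : rightMul Γ S y = y + n • s) (hU : rightMul Γ U y = y + n • u) :
    ∃ (k : ℤ) (w : Cosets Γ →₀ ℤ), y = k • cosetSum Γ + n • w := by
  let H : Subgroup SL(2, ℤ) :=
    { carrier := {h | ∀ x, (n : ℤ) ∣ y (cosetMul Γ (toPSL h) x) - y x}
      one_mem' := fun x => by simp
      mul_mem' := fun {h h'} hh hh' x => by
        have := dvd_add (hh' (cosetMul Γ (toPSL h) x)) (hh x)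
        rwa [sub_add_sub_cancel, cosetMul_cosetMul, ← map_mul] at this
      inv_mem' := fun {h} hh x => by
        have := hh (cosetMul Γ (toPSL h⁻¹) x)
        rwa [cosetMul_cosetMul, ← map_mul, inv_mul_cancel, map_one, cosetMul_one,
          dvd_sub_comm] at this }
  have key : ∀ {h v}, rightMul Γ h y = y + n • v → h ∈ H := fun {h v} e x => by
    have := DFunLike.congr_fun e (cosetMul Γ (toPSL h) x)
    rw [rightMul_apply, Finsupp.add_apply, Finsupp.smul_apply, nsmul_eq_mul] at this
    rw [dvd_sub_comm, this, add_sub_cancel_left]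
    exact dvd_mul_right _ _
  have hH : ∀ h, h ∈ H := mem_of_S_mem_of_U_mem (key hS) (key hU)
  have hd : ∀ x, ∃ w, y x - y (coset Γ 1) = n * w := fun x => by
    obtain ⟨g, rfl⟩ := exists_coset_eq Γ x
    have := hH g (coset Γ 1)
    rwa [cosetMul_coset, one_mul] at this
  choose w hw using hd
  refine ⟨y (coset Γ 1), Finsupp.equivFunOnFinite.symm w, ?_⟩
  ext x
  have := hw x
  simp
  linarith

end Cusps

/-! ### Kernel and cokernel of the Manin map -/

section Manin

variable {Γ : Subgroup SL(2, ℤ)}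

variable (Γ) in
/-- The homomorphism from `ℤ[Γ \ PSL₂(ℤ)]` to the cokernel of the Manin map, `Γ g ↦ {g, g T}`. -/
noncomputable def toCokerManin : (Cosets Γ →₀ ℤ) →+ SymbolsLevel Γ ⧸ (maninMap Γ).range :=
  (QuotientAddGroup.mk' _).comp (symbolMap Γ T)

variable (Γ) in
-- {g, gT} and {g, gU} differ by the Manin symbol {gU, gUS}.
theorem toCokerManin_apply (b : Cosets Γ →₀ ℤ) :
    toCokerManin Γ b = QuotientAddGroup.mk (symbolMap Γ U b) := by
  refine QuotientAddGroup.eq_iff_sub_mem.mpr ?_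
  rw [symbolMap_T, add_sub_cancel_left]
  exact ⟨_, rfl⟩

variable (Γ) in
theorem toCokerManin_surjective : Function.Surjective (toCokerManin Γ) := fun m => by
  obtain ⟨m, rfl⟩ := QuotientAddGroup.mk'_surjective _ m
  obtain ⟨a, b, rfl⟩ := exists_symbolMap_add_symbolMap Γ m
  refine ⟨b, ?_⟩
  rw [toCokerManin_apply]
  refine QuotientAddGroup.eq_iff_sub_mem.mpr ?_
  rw [sub_add_cancel_right, neg_mem_iff]
  exact ⟨a, rfl⟩

variable [Γ.FiniteIndex]

/-- Replaces the saturation by an integral condition: the element zT − z, known only after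
multiplication by n, is divided by n after removal of a multiple of Σ, which is invariant under
everything. -/
theorem mem_pairRelations_iff_exists {a b : Cosets Γ →₀ ℤ} :
    (a, b) ∈ pairRelations Γ ↔ ∃ w : Cosets Γ →₀ ℤ, cuspMap Γ w = 0 ∧
      a - rightMul Γ U w ∈ fixedBy Γ S ∧ b - w ∈ fixedBy Γ U := by
  rw [mem_pairRelations]
  constructor
  · rintro ⟨n, hn, z, hs, hu⟩
    generalize hy : rightMul Γ T z - z = y at hs hu
    have hs' := (mem_fixedBy Γ).mp hs
    have hu' := (mem_fixedBy Γ).mp hu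
    rw [map_sub, map_nsmul] at hs' hu'
    have hU : rightMul Γ U y = y + n • (rightMul Γ U b - b) := by
      rw [smul_sub, ← sub_eq_zero, ← sub_eq_zero.mpr hu'.symm]
      abel
    -- Modulo n, y agrees with yU, and yU is S-invariant because na − yU is.
    have hS : rightMul Γ S y = y + n • ((rightMul Γ U b - b) + (rightMul Γ S a - a) -
        rightMul Γ S (rightMul Γ U b - b)) := by
      have e : y = rightMul Γ U y - n • (rightMul Γ U b - b) := by rw [hU, add_sub_cancel_right]
      have e' := congrArg (rightMul Γ S) e
      rw [map_sub, map_nsmul] at e'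
      have e'' : rightMul Γ S (rightMul Γ U y) = rightMul Γ U y + n • (rightMul Γ S a - a) := by
        rw [smul_sub, ← sub_eq_zero, ← sub_eq_zero.mpr hs'.symm]
        abel
      rw [e', e'', hU]
      simp only [smul_sub, smul_add]
      abel
    obtain ⟨k, w, hw⟩ := exists_eq_zsmul_cosetSum_add Γ hS hU
    refine ⟨w, cuspMap_eq_zero_of_nsmul Γ hn (k := -k) ?_,
      mem_fixedBy_of_nsmul_mem Γ hn ?_, mem_fixedBy_of_nsmul_mem Γ hn ?_⟩
    · have h0 : freeCuspMap Γ y = 0 := by rw [← hy, map_sub, freeCuspMap_rightMul_T, sub_self]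
      rw [hw, map_add, map_zsmul, map_nsmul] at h0
      rw [neg_smul]
      exact (neg_eq_of_add_eq_zero_right h0).symm
    · have := (fixedBy Γ S).add_mem hs ((fixedBy Γ S).zsmul_mem (cosetSum_mem_fixedBy Γ S) k)
      rw [hw, map_add, map_zsmul, map_nsmul, rightMul_cosetSum] at this
      convert this using 1
      rw [smul_sub]
      abel
    · have := (fixedBy Γ U).add_mem hu ((fixedBy Γ U).zsmul_mem (cosetSum_mem_fixedBy Γ U) k)
      rw [hw] at this
      convert this using 1
      rw [smul_sub]
      abel
  · rintro ⟨w, hw, ha, hb⟩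
    obtain ⟨m, z, hz⟩ := exists_of_cuspMap_eq_zero Γ hw
    -- The multiple n = d_Γ suffices, since d_Γ w = mΣ + (zT − z).
    refine ⟨widthGcd Γ, widthGcd_ne_zero Γ, z, ?_, ?_⟩
    · have := (fixedBy Γ S).add_mem ((fixedBy Γ S).nsmul_mem ha (widthGcd Γ))
        ((fixedBy Γ S).zsmul_mem (cosetSum_mem_fixedBy Γ S) m)
      rw [smul_sub, ← map_nsmul, hz, map_add, map_zsmul, rightMul_cosetSum] at this
      convert this using 1
      abel
    · have := (fixedBy Γ U).add_mem ((fixedBy Γ U).nsmul_mem hb (widthGcd Γ))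
        ((fixedBy Γ U).zsmul_mem (cosetSum_mem_fixedBy Γ U) m)
      rw [smul_sub, hz] at this
      convert this using 1
      abel

variable (Γ)

theorem ker_maninMap :
    (maninMap Γ).ker = fixedBy Γ S ⊔ (fixedBy Γ U ⊓ (cuspMap Γ).ker) := by
  ext a
  have h : a ∈ (maninMap Γ).ker ↔ (a, 0) ∈ pairRelations Γ := by
    rw [← symbolMap_add_eq_zero_iff, map_zero, add_zero]
    rfl
  rw [h, mem_pairRelations_iff_exists, AddSubgroup.mem_sup]
  constructor
  · rintro ⟨w, hw, ha, hb⟩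
    rw [zero_sub, neg_mem_iff] at hb
    rw [(mem_fixedBy Γ).mp hb] at ha
    exact ⟨_, ha, w, ⟨hb, hw⟩, sub_add_cancel a w⟩
  · rintro ⟨s, hs, w, ⟨hw, hw'⟩, rfl⟩
    refine ⟨w, hw', ?_, ?_⟩
    · rwa [(mem_fixedBy Γ).mp hw, add_sub_cancel_right]
    · rwa [zero_sub, neg_mem_iff]

/-- The homomorphism from `ℤ[Γ \ PSL₂(ℤ)]` to the cokernel of the restriction of `φ_Γ`. -/
noncomputable def toCokerCusp :
    (Cosets Γ →₀ ℤ) →+ CuspQuotient Γ ⧸ (fixedBy Γ U).map (cuspMap Γ) :=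
  (QuotientAddGroup.mk' _).comp (cuspMap Γ)

theorem toCokerCusp_surjective : Function.Surjective (toCokerCusp Γ) :=
  (QuotientAddGroup.mk'_surjective _).comp (cuspMap_surjective Γ)

theorem ker_toCokerManin : (toCokerManin Γ).ker = (toCokerCusp Γ).ker := by
  ext b
  have h1 : b ∈ (toCokerManin Γ).ker ↔ ∃ a, (a, b) ∈ pairRelations Γ := by
    rw [AddMonoidHom.mem_ker, toCokerManin_apply, QuotientAddGroup.eq_zero_iff]
    constructor
    · rintro ⟨a, ha⟩
      refine ⟨-a, (symbolMap_add_eq_zero_iff _ _).mp ?_⟩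
      rw [← ha, map_neg]
      exact neg_add_cancel _
    · rintro ⟨a, ha⟩
      refine ⟨-a, ?_⟩
      rw [map_neg]
      exact neg_eq_of_add_eq_zero_right ((symbolMap_add_eq_zero_iff _ _).mpr ha)
  have h2 : b ∈ (toCokerCusp Γ).ker ↔ ∃ u ∈ fixedBy Γ U, cuspMap Γ u = cuspMap Γ b :=
    QuotientAddGroup.eq_zero_iff _
  rw [h1, h2]
  constructor
  · rintro ⟨a, ha⟩
    obtain ⟨w, hw, -, hb⟩ := mem_pairRelations_iff_exists.mp ha
    exact ⟨_, hb, by rw [map_sub, hw, sub_zero]⟩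
  · rintro ⟨u, hu, h⟩
    -- Any a is allowed, so with w = b − u the choice a = wU makes the S-condition void.
    refine ⟨rightMul Γ U (b - u), mem_pairRelations_iff_exists.mpr ⟨b - u, ?_, ?_, ?_⟩⟩
    · rw [map_sub, h, sub_self]
    · rw [sub_self]; exact zero_mem _
    · rwa [sub_sub_cancel]

/-- The cokernel of the restriction of `φ_Γ` is isomorphic to the cokernel of the Manin map. -/
noncomputable def cokerEquiv :
    (CuspQuotient Γ ⧸ (fixedBy Γ U).map (cuspMap Γ)) ≃+
      (SymbolsLevel Γ ⧸ (maninMap Γ).range) :=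
  ((QuotientAddGroup.quotientKerEquivOfSurjective _ (toCokerCusp_surjective Γ)).symm.trans
    (QuotientAddGroup.quotientAddEquivOfEq (ker_toCokerManin Γ).symm)).trans
    (QuotientAddGroup.quotientKerEquivOfSurjective _ (toCokerManin_surjective Γ))

theorem cokerEquiv_toCokerCusp (a : Cosets Γ →₀ ℤ) :
    cokerEquiv Γ (toCokerCusp Γ a) = toCokerManin Γ a := by
  have h : (QuotientAddGroup.quotientKerEquivOfSurjective _ (toCokerCusp_surjective Γ)).symm
      (toCokerCusp Γ a) = QuotientAddGroup.mk a :=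
    (AddEquiv.symm_apply_eq _).mpr rfl
  rw [cokerEquiv, AddEquiv.trans_apply, AddEquiv.trans_apply, h]
  rfl

theorem cokerEquiv_cuspClass (g : SL(2, ℤ)) :
    cokerEquiv Γ (QuotientAddGroup.mk (cuspClass Γ (cusp Γ g))) =
      QuotientAddGroup.mk (symbLevel Γ g (g * T)) := by
  have h := cokerEquiv_toCokerCusp Γ (Finsupp.single (coset Γ (toPSL g)) 1)
  rw [toCokerCusp, toCokerManin, AddMonoidHom.comp_apply, AddMonoidHom.comp_apply,
    cuspMap_single, symbolMap_single] at h
  exact h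

theorem index_range_maninMap :
    (maninMap Γ).range.index = ((fixedBy Γ U).map (cuspMap Γ)).index :=
  (Nat.card_congr (cokerEquiv Γ).toEquiv).symm

end Manin

/-! ### Index of the image of the Manin map -/

section Index

variable (Γ : Subgroup SL(2, ℤ))

theorem cosetMul_U_eq_iff (g : SL(2, ℤ)) :
    cosetMul Γ (toPSL U) (coset Γ (toPSL g)) = coset Γ (toPSL g) ↔
      g * U * g⁻¹ ∈ Γ ∨ -(g * U * g⁻¹) ∈ Γ := by
  rw [← coset_eq_iff, cosetMul_coset, ← map_mul, eq_comm]

/-- The degree modulo `3` on a free abelian group. -/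
noncomputable def degreeModThree (X : Type*) : (X →₀ ℤ) →+ ZMod 3 :=
  Finsupp.liftAddHom fun _ => Int.castAddHom (ZMod 3)

theorem degreeModThree_single {X : Type*} (x : X) : degreeModThree X (Finsupp.single x 1) = 1 := by
  simp [degreeModThree]

theorem degreeModThree_freeCuspMap (a : Cosets Γ →₀ ℤ) :
    degreeModThree _ (freeCuspMap Γ a) = degreeModThree _ a := by
  refine DFunLike.congr_fun (f := (degreeModThree _).comp (freeCuspMap Γ))
    (hom_ext_of_single fun g => ?_) a
  rw [AddMonoidHom.comp_apply, freeCuspMap_single, degreeModThree_single, degreeModThree_single]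

variable [Γ.FiniteIndex]

/-- The class of the cusp `Γ g ∞` in the cokernel of the restriction of `φ_Γ`. -/
noncomputable def cuspCokerClass (g : SL(2, ℤ)) :
    CuspQuotient Γ ⧸ (fixedBy Γ U).map (cuspMap Γ) :=
  toCokerCusp Γ (Finsupp.single (coset Γ (toPSL g)) 1)

theorem toCokerCusp_eq_zero {a : Cosets Γ →₀ ℤ} (ha : a ∈ fixedBy Γ U) : toCokerCusp Γ a = 0 :=
  (QuotientAddGroup.eq_zero_iff _).mpr ⟨a, ha, rfl⟩

theorem cuspCokerClass_eq {g g' : SL(2, ℤ)} (h : cusp Γ g = cusp Γ g') :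
    cuspCokerClass Γ g = cuspCokerClass Γ g' := by
  rw [cuspCokerClass, cuspCokerClass, toCokerCusp, AddMonoidHom.comp_apply,
    AddMonoidHom.comp_apply, cuspMap_single, cuspMap_single, h]

theorem cuspCokerClass_neg (g : SL(2, ℤ)) : cuspCokerClass Γ (-g) = cuspCokerClass Γ g :=
  cuspCokerClass_eq Γ (cusp_neg Γ g)

theorem cuspCokerClass_mul_T_zpow (g : SL(2, ℤ)) (n : ℤ) :
    cuspCokerClass Γ (g * T ^ n) = cuspCokerClass Γ g :=
  cuspCokerClass_eq Γ (cusp_mul_T_zpow Γ g n)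

theorem cuspCokerClass_mul_T (g : SL(2, ℤ)) :
    cuspCokerClass Γ (g * T) = cuspCokerClass Γ g := by
  simpa using cuspCokerClass_mul_T_zpow Γ g 1

theorem U_mul_U : U * U = S * T ^ (-1 : ℤ) := by
  rw [zpow_neg_one, eq_mul_inv_iff_mul_eq, ← mul_right_inj U, ← neg_inj]
  have h : U * S = -T := U_mul_S
  rw [h, neg_neg, ← mul_assoc, ← mul_assoc, U_mul_U_mul_U, neg_mul, one_mul, neg_neg]

/-- The three vertices of an ideal triangle of the Farey tessellation have sum zero. -/
theorem cuspCokerClass_triangle (g : SL(2, ℤ)) :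
    cuspCokerClass Γ g + cuspCokerClass Γ (g * T * S) + cuspCokerClass Γ (g * S) = 0 := by
  have h := toCokerCusp_eq_zero Γ
    (add_rightMul_U_mem_fixedBy Γ (Finsupp.single (coset Γ (toPSL g)) 1))
  rw [rightMul_rightMul, map_add, map_add, rightMul_single, rightMul_single, cosetMul_coset,
    cosetMul_coset, ← map_mul, ← map_mul, U_mul_U, ← mul_assoc] at h
  rw [mul_assoc, T_mul_S, ← cuspCokerClass_mul_T_zpow Γ (g * S) (-1)]
  exact h

/-- With V = STS⁻¹, right multiplication by T, V² and V^N preserves the class. As N is odd, V does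
too, and T and V generate SL₂(ℤ). -/
theorem cuspCokerClass_eq_one {N : ℕ} (hN : Odd N) (hΓ : CongruenceSubgroup.Gamma N ≤ Γ)
    (g : SL(2, ℤ)) : cuspCokerClass Γ g = cuspCokerClass Γ 1 := by
  let H : Subgroup SL(2, ℤ) :=
    { carrier := {k | ∀ g, cuspCokerClass Γ (g * k) = cuspCokerClass Γ g}
      one_mem' := fun g => by rw [mul_one]
      mul_mem' := fun {k k'} hk hk' g => by rw [← mul_assoc, hk', hk]
      inv_mem' := fun {k} hk g => by
        have := hk (g * k⁻¹)
        rwa [inv_mul_cancel_right, eq_comm] at this }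
  have hT : T ∈ H := cuspCokerClass_mul_T Γ
  have hV2 : (S * T * S⁻¹) ^ 2 ∈ H := fun g => by
    have hS : S⁻¹ = -S := by
      rw [inv_eq_iff_mul_eq_one, mul_neg, S_mul_S, neg_neg]
    -- These two triangles share the edge from gS∞ to gSTS∞; the opposite vertices are g∞ and gST²S∞
    -- = gV²∞.
    have h1 := cuspCokerClass_triangle Γ (g * S)
    have h2 := cuspCokerClass_triangle Γ (g * S * T)
    rw [cuspCokerClass_mul_T, add_right_comm, ← h1, add_right_inj] at h2
    have e : g * (S * T * S⁻¹) ^ 2 = -(g * S * T * T * S) := by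
      rw [conj_pow, hS, pow_two]
      simp only [mul_neg, mul_assoc]
    rw [e, cuspCokerClass_neg, h2, mul_assoc, S_mul_S, mul_neg, mul_one, cuspCokerClass_neg]
  -- V^N lies in the normal subgroup Γ(N), so gV^N is a left translate of g by an element of Γ.
  have hVN : (S * T * S⁻¹) ^ N ∈ H := fun g => by
    have hT : T ^ N ∈ CongruenceSubgroup.Gamma N := by
      simpa using CongruenceSubgroup.ModularGroup_T_pow_mem_Gamma N N dvd_rfl
    have hn := CongruenceSubgroup.Gamma_normal N
    have hk := hΓ (hn.conj_mem _ (hn.conj_mem _ hT S) g)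
    rw [conj_pow, ← cuspCokerClass_eq Γ (cusp_mul hk g), inv_mul_cancel_right]
  have hV : S * T * S⁻¹ ∈ H := by
    obtain ⟨m, rfl⟩ := hN
    rw [pow_succ, pow_mul] at hVN
    exact (Subgroup.mul_mem_cancel_left H (H.pow_mem hV2 m)).mp hVN
  have hS : S ∈ H := by
    have e : (T * (S * T * S⁻¹) * T)⁻¹ = S := by
      have hS : S⁻¹ = -S := by rw [inv_eq_iff_mul_eq_one, mul_neg, S_mul_S, neg_neg]
      rw [hS]
      refine inv_eq_of_mul_eq_one_left ?_
      ext i j; fin_cases i <;> fin_cases j <;> rfl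
    rw [← e]
    exact H.inv_mem (H.mul_mem (H.mul_mem hT hV) hT)
  have hU : U ∈ H := by
    rw [← T_mul_S]
    exact H.mul_mem hT hS
  simpa using mem_of_S_mem_of_U_mem hS hU g 1

theorem index_eq_addOrderOf {N : ℕ} (hN : Odd N) (hΓ : CongruenceSubgroup.Gamma N ≤ Γ) :
    (maninMap Γ).range.index = addOrderOf (cuspCokerClass Γ 1) := by
  rw [index_range_maninMap, AddSubgroup.index, ← Nat.card_zmultiples]
  have : AddSubgroup.zmultiples (cuspCokerClass Γ 1) = ⊤ := by
    rw [eq_top_iff]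
    rintro m -
    obtain ⟨a, rfl⟩ := toCokerCusp_surjective Γ m
    induction a using Finsupp.induction_linear with
    | zero => rw [map_zero]; exact zero_mem _
    | add a b ha hb => rw [map_add]; exact add_mem ha hb
    | single x n =>
      obtain ⟨g, rfl⟩ := exists_coset_eq Γ x
      refine AddSubgroup.mem_zmultiples_iff.mpr ⟨n, ?_⟩
      rw [← cuspCokerClass_eq_one Γ hN hΓ g, cuspCokerClass, ← map_zsmul, Finsupp.smul_single,
        smul_eq_mul, mul_one]
  rw [this]
  exact Nat.card_congr AddSubgroup.topEquiv.symm.toEquiv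

theorem index_dvd_three {N : ℕ} (hN : Odd N) (hΓ : CongruenceSubgroup.Gamma N ≤ Γ) :
    (maninMap Γ).range.index ∣ 3 := by
  rw [index_eq_addOrderOf Γ hN hΓ]
  refine addOrderOf_dvd_of_nsmul_eq_zero ?_
  have h := cuspCokerClass_triangle Γ 1
  rw [cuspCokerClass_eq_one Γ hN hΓ (1 * T * S), cuspCokerClass_eq_one Γ hN hΓ (1 * S)] at h
  rwa [succ_nsmul, two_nsmul]

/-- A coset fixed by U is itself a U-invariant element, so its cusp, whose class generates the
cokernel, has class zero. -/
theorem index_eq_one {N : ℕ} (hN : Odd N) (hΓ : CongruenceSubgroup.Gamma N ≤ Γ) {x : Cosets Γ}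
    (hx : cosetMul Γ (toPSL U) x = x) : (maninMap Γ).range.index = 1 := by
  obtain ⟨g, rfl⟩ := exists_coset_eq Γ x
  have h : cuspCokerClass Γ g = 0 := toCokerCusp_eq_zero Γ (by
    rw [mem_fixedBy, rightMul_single, hx])
  rw [index_eq_addOrderOf Γ hN hΓ, ← cuspCokerClass_eq_one Γ hN hΓ g, h, addOrderOf_zero]

/-- U permutes each level set of a with order dividing 3 and no fixed points, so each level set has
cardinality divisible by 3. -/
theorem degreeModThree_eq_zero (hU : ∀ x, cosetMul Γ (toPSL U) x ≠ x) {a : Cosets Γ →₀ ℤ}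
    (ha : a ∈ fixedBy Γ U) : degreeModThree _ a = 0 := by
  classical
  let _ := Fintype.ofFinite (Cosets Γ)
  have hinv : ∀ x, a (cosetMul Γ (toPSL U) x) = a x := fun x => by
    conv_lhs => rw [← (mem_fixedBy Γ).mp ha, rightMul_apply]
  have hsum : degreeModThree _ a = ∑ x, (a x : ZMod 3) := by
    simp [degreeModThree, Finsupp.sum_fintype]
  rw [hsum, Finset.sum_comp (fun n : ℤ => (n : ZMod 3)) a]
  refine Finset.sum_eq_zero fun n _ => ?_
  let f : Function.End {x // a x = n} :=
    fun x => ⟨cosetMul Γ (toPSL U) x, (hinv x).trans x.2⟩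
  have hf : f ^ 3 ^ 1 = 1 := by
    funext x
    refine Subtype.ext ?_
    change cosetMul Γ _ (cosetMul Γ _ (cosetMul Γ _ x)) = x
    rw [cosetMul_cosetMul, cosetMul_cosetMul, ← pow_two, ← pow_succ', toPSL_U_cube, cosetMul_one]
  have : Fact (Nat.Prime 3) := ⟨Nat.prime_three⟩
  have hcard := Equiv.Perm.card_fixedPoints_modEq hf
  have : IsEmpty (Function.fixedPoints f) := ⟨fun x => hU x (congrArg Subtype.val x.2)⟩
  rw [Fintype.card_eq_zero (α := Function.fixedPoints f), Fintype.card_subtype] at hcard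
  rw [nsmul_eq_mul, (ZMod.natCast_eq_zero_iff _ 3).mpr (Nat.modEq_zero_iff_dvd.mp hcard),
    zero_mul]

/-- Since T ∈ Γ, the cusp Γ∞ has width 1, so d_Γ = 1 and the width element is the image of Σ. Degree
modulo 3 vanishes on it and on the images of U-invariants, but is 1 on a cusp. -/
theorem index_ne_one (hT : T ∈ Γ) (hU : ∀ x, cosetMul Γ (toPSL U) x ≠ x) :
    (maninMap Γ).range.index ≠ 1 := by
  intro h
  rw [index_range_maninMap, AddSubgroup.index_eq_one] at h
  have hw : width Γ (cusp Γ 1) = 1 := by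
    refine le_antisymm (Nat.sInf_le ⟨one_pos, 1, rfl, .inl ?_⟩) (width_pos Γ _)
    simpa using hT
  have hd : widthGcd Γ = 1 := by
    have := widthGcd_dvd Γ (cusp Γ 1)
    rwa [hw, Nat.dvd_one] at this
  obtain ⟨u, hu, e⟩ := h ▸ AddSubgroup.mem_top (cuspClass Γ (cusp Γ 1))
  rw [cuspMap_apply, ← sub_eq_zero, cuspClass, ← map_sub, toCuspQuotient_eq_zero_iff] at e
  obtain ⟨m, hm⟩ := e
  have e' := congrArg (degreeModThree _) hm
  have hN := freeCuspMap_cosetSum Γ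
  rw [hd, one_smul] at hN
  rw [map_zsmul, map_sub, ← hN, degreeModThree_freeCuspMap, degreeModThree_freeCuspMap,
    degreeModThree_eq_zero Γ hU hu, degreeModThree_eq_zero Γ hU (cosetSum_mem_fixedBy Γ U),
    degreeModThree_single] at e'
  revert e'
  simp

end Index

/-! ### The groups `Γ₀(p ^ n)` and `Γ₁(p ^ n)` -/

section Congruence

theorem trace_conj_U (g : SL(2, ℤ)) : (g * U * g⁻¹) 0 0 + (g * U * g⁻¹) 1 1 = 1 := by
  have h := Matrix.trace_mul_cycle (g : Matrix (Fin 2) (Fin 2) ℤ) U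
    ((g⁻¹ : SL(2, ℤ)) : Matrix (Fin 2) (Fin 2) ℤ)
  rw [← Matrix.SpecialLinearGroup.coe_mul, ← Matrix.SpecialLinearGroup.coe_mul,
    ← Matrix.SpecialLinearGroup.coe_mul, ← Matrix.SpecialLinearGroup.coe_mul, inv_mul_cancel,
    one_mul, Matrix.trace_fin_two, Matrix.trace_fin_two] at h
  rw [h]
  simp [coe_U]

/-- The trace would be 1 or −1, while Γ₁(N) forces 2 modulo N; then N divides 1 or 3. -/
theorem conj_U_notMem_Gamma1 {N : ℕ} (hN : 3 < N) (g : SL(2, ℤ)) :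
    ¬ (g * U * g⁻¹ ∈ CongruenceSubgroup.Gamma1 N ∨
      -(g * U * g⁻¹) ∈ CongruenceSubgroup.Gamma1 N) := by
  have htr := congrArg (Int.cast : ℤ → ZMod N) (trace_conj_U g)
  rw [Int.cast_add, Int.cast_one] at htr
  have key : ∀ m : ℕ, 0 < m → m ≤ 3 → (m : ZMod N) ≠ 0 := fun m hm hm' h => by
    have := Nat.le_of_dvd hm ((ZMod.natCast_eq_zero_iff _ _).mp h)
    omega
  rintro (h | h) <;> obtain ⟨h0, h1, -⟩ := (CongruenceSubgroup.Gamma1_mem N _).mp h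
  · refine key 1 (by simp) (by simp) ?_
    rw [h0, h1] at htr
    push_cast
    linear_combination htr
  · refine key 3 (by simp) le_rfl ?_
    simp only [Matrix.SpecialLinearGroup.coe_neg, Matrix.neg_apply, Int.cast_neg] at h0 h1
    push_cast
    linear_combination -h0 - h1 - htr

/-- Modulo p the conjugate is upper triangular with diagonal a, d satisfying a + d = ad = 1. So a² −
a + 1 = 0, −a has order 3, and 3 divides p − 1. -/
theorem conj_U_notMem_Gamma0 {p n : ℕ} (hp : p.Prime) (h5 : 5 ≤ p) (hn : 1 ≤ n)
    (hp3 : ¬ p ≡ 1 [MOD 3]) (g : SL(2, ℤ)) :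
    ¬ (g * U * g⁻¹ ∈ CongruenceSubgroup.Gamma0 (p ^ n) ∨
      -(g * U * g⁻¹) ∈ CongruenceSubgroup.Gamma0 (p ^ n)) := by
  intro h
  have : Fact p.Prime := ⟨hp⟩
  have h10 : (((g * U * g⁻¹) 1 0 : ℤ) : ZMod (p ^ n)) = 0 := by
    rcases h with h | h
    · exact CongruenceSubgroup.Gamma0_mem.mp h
    · simpa using CongruenceSubgroup.Gamma0_mem.mp h
  have h10' : (((g * U * g⁻¹) 1 0 : ℤ) : ZMod p) = 0 := by
    rw [ZMod.intCast_zmod_eq_zero_iff_dvd] at h10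
    rw [ZMod.intCast_zmod_eq_zero_iff_dvd]
    exact (by exact_mod_cast dvd_pow_self p (by omega : n ≠ 0) : (p : ℤ) ∣ (p ^ n : ℕ)).trans h10
  have htr := congrArg (Int.cast : ℤ → ZMod p) (trace_conj_U g)
  have hdet := (g * U * g⁻¹).det_coe
  rw [Matrix.det_fin_two] at hdet
  have hdet' := congrArg (Int.cast : ℤ → ZMod p) hdet
  push_cast at htr hdet'
  rw [h10', mul_zero, sub_zero] at hdet'
  generalize (((g * U * g⁻¹) 0 0 : ℤ) : ZMod p) = a at htr hdet'
  generalize (((g * U * g⁻¹) 1 1 : ℤ) : ZMod p) = d at htr hdet'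
  have h3 : (3 : ZMod p) ≠ 0 := fun h => by
    have := Nat.le_of_dvd (by simp) ((ZMod.natCast_eq_zero_iff 3 p).mp (by exact_mod_cast h))
    omega
  have ha : a ^ 2 - a + 1 = 0 := by linear_combination a * htr - hdet'
  have hord : orderOf (-a) = 3 := by
    refine orderOf_eq_prime ?_ ?_
    · linear_combination (-a - 1) * ha
    · intro h
      refine h3 ?_
      linear_combination ha - (2 - a) * h
  have hdvd := ZMod.orderOf_dvd_card_sub_one (p := p) (a := -a) (by
    intro h
    rw [h] at hord
    simp at hord)
  rw [hord] at hdvd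
  exact hp3 ((Nat.modEq_iff_dvd' (by omega)).mpr hdvd).symm

/-- Since 3 divides φ(pⁿ), there is a unit c of order 3, so pⁿ divides (c − 1)(c² + c + 1). As p ≠
3, it cannot divide both factors, and pⁿ does not divide c − 1. -/
theorem exists_sq_add_self_add_one {p n : ℕ} (hp : p.Prime) (h5 : 5 ≤ p) (hn : 1 ≤ n)
    (hp3 : p ≡ 1 [MOD 3]) : ∃ c : ℤ, ((p ^ n : ℕ) : ℤ) ∣ c ^ 2 + c + 1 := by
  have : NeZero (p ^ n) := ⟨pow_ne_zero _ hp.ne_zero⟩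
  have : Fact (Nat.Prime 3) := ⟨Nat.prime_three⟩
  have hdvd : 3 ∣ Fintype.card (ZMod (p ^ n))ˣ := by
    rw [ZMod.card_units_eq_totient, Nat.totient_prime_pow hp hn]
    exact ((Nat.modEq_iff_dvd' (by omega)).mp hp3.symm).mul_left _
  obtain ⟨u, hu⟩ := exists_prime_orderOf_dvd_card 3 hdvd
  obtain ⟨c, hc⟩ := ZMod.intCast_surjective (u : ZMod (p ^ n))
  have hu3 : (u : ZMod (p ^ n)) ^ 3 = 1 := by
    rw [← Units.val_pow_eq_pow_val, ← hu, pow_orderOf_eq_one, Units.val_one]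
  have hmul : ((p ^ n : ℕ) : ℤ) ∣ (c - 1) * (c ^ 2 + c + 1) := by
    rw [← ZMod.intCast_zmod_eq_zero_iff_dvd]
    push_cast
    rw [hc]
    linear_combination hu3
  have hne : ¬ ((p ^ n : ℕ) : ℤ) ∣ c - 1 := by
    rw [← ZMod.intCast_zmod_eq_zero_iff_dvd]
    push_cast
    rw [hc, sub_eq_zero, Units.val_eq_one]
    rintro rfl
    simp at hu
  have hpi : Prime (p : ℤ) := Nat.prime_iff_prime_int.mp hp
  push_cast at hmul hne ⊢
  refine ⟨c, ?_⟩
  have hcop : ¬ (p : ℤ) ∣ c - 1 := by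
    intro h
    refine hne (IsCoprime.dvd_of_dvd_mul_right (IsCoprime.pow_left ?_) hmul)
    refine (Irreducible.coprime_iff_not_dvd hpi.irreducible).mpr fun h' => ?_
    have h3 : (p : ℤ) ∣ 3 := by
      -- c² + c + 1 − (c − 1)(c + 2) = 3.
      have := dvd_sub h' (h.mul_right (c + 2))
      ring_nf at this
      exact this
    have := Int.le_of_dvd (by norm_num) h3
    omega
  exact IsCoprime.dvd_of_dvd_mul_left (IsCoprime.pow_left
    ((Irreducible.coprime_iff_not_dvd hpi.irreducible).mpr hcop)) hmul

theorem exists_cosetMul_U_eq {p n : ℕ} (hp : p.Prime) (h5 : 5 ≤ p) (hn : 1 ≤ n)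
    (hp3 : p ≡ 1 [MOD 3]) : ∃ x : Cosets (CongruenceSubgroup.Gamma0 (p ^ n)),
      cosetMul _ (toPSL U) x = x := by
  have : NeZero (p ^ n) := ⟨pow_ne_zero _ hp.ne_zero⟩
  obtain ⟨c, hc⟩ := exists_sq_add_self_add_one hp h5 hn hp3
  -- Conjugating U by this unipotent matrix gives lower left entry c² + c + 1.
  let g : SL(2, ℤ) := ⟨!![1, 0; c, 1], by simp [Matrix.det_fin_two]⟩
  refine ⟨coset _ (toPSL g), (cosetMul_U_eq_iff _ g).mpr (.inl ?_)⟩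
  rw [CongruenceSubgroup.Gamma0_mem, ZMod.intCast_zmod_eq_zero_iff_dvd]
  have e : (g * U * g⁻¹) 1 0 = c ^ 2 + c + 1 := by
    have hg : (g : Matrix (Fin 2) (Fin 2) ℤ) = !![1, 0; c, 1] := rfl
    simp only [mul_entry, coe_U, Matrix.SpecialLinearGroup.coe_inv, Matrix.adjugate_fin_two, hg]
    simp
    ring
  rwa [e]

end Congruence

end MixedModularSymbols

/-! ### Assembly of the three statements -/

theorem theorem1p2 :
    (∀ (Γ : Subgroup SL(2, ℤ)) [Γ.FiniteIndex],
      (∃ e : (MixedModularSymbols.CuspQuotient Γ ⧸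
            (MixedModularSymbols.fixedBy Γ MixedModularSymbols.U).map
              (MixedModularSymbols.cuspMap Γ)) ≃+
          (MixedModularSymbols.SymbolsLevel Γ ⧸ (MixedModularSymbols.maninMap Γ).range),
        ∀ g : SL(2, ℤ),
          e (QuotientAddGroup.mk
              (MixedModularSymbols.cuspClass Γ (MixedModularSymbols.cusp Γ g))) =
            QuotientAddGroup.mk (MixedModularSymbols.symbLevel Γ g (g * ModularGroup.T))) ∧
      (MixedModularSymbols.maninMap Γ).ker =
        MixedModularSymbols.fixedBy Γ ModularGroup.S ⊔
          (MixedModularSymbols.fixedBy Γ MixedModularSymbols.U ⊓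
            (MixedModularSymbols.cuspMap Γ).ker)) ∧
    (∀ (p n : ℕ), p.Prime → 5 ≤ p → 1 ≤ n → ∀ Γ : Subgroup SL(2, ℤ),
      Γ = CongruenceSubgroup.Gamma1 (p ^ n) ∨ Γ = CongruenceSubgroup.Gamma0 (p ^ n) →
      (MixedModularSymbols.maninMap Γ).range.index ∣ 3 ∧
      ((MixedModularSymbols.maninMap Γ).range.index = 1 ↔
        p ≡ 1 [MOD 3] ∧ Γ = CongruenceSubgroup.Gamma0 (p ^ n))) := by
  refine ⟨fun Γ _ => ⟨⟨MixedModularSymbols.cokerEquiv Γ,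
    MixedModularSymbols.cokerEquiv_cuspClass Γ⟩, MixedModularSymbols.ker_maninMap Γ⟩, ?_⟩
  intro p n hp h5 hn Γ hΓ
  have : NeZero (p ^ n) := ⟨pow_ne_zero _ hp.ne_zero⟩
  have hodd : Odd (p ^ n) := (hp.odd_of_ne_two (by omega)).pow
  have hle1 : CongruenceSubgroup.Gamma (p ^ n) ≤ CongruenceSubgroup.Gamma1 (p ^ n) := by
    intro γ hγ
    have h := CongruenceSubgroup.Gamma_mem.mp hγ
    exact (CongruenceSubgroup.Gamma1_mem _ _).mpr ⟨h.1, h.2.2.2, h.2.2.1⟩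
  have hle0 := hle1.trans (CongruenceSubgroup.Gamma1_in_Gamma0 (p ^ n))
  have hT1 : ModularGroup.T ∈ CongruenceSubgroup.Gamma1 (p ^ n) := by
    simp [CongruenceSubgroup.Gamma1_mem, ModularGroup.coe_T]
  have hT0 := CongruenceSubgroup.Gamma1_in_Gamma0 (p ^ n) hT1
  have h1 : (MixedModularSymbols.maninMap (CongruenceSubgroup.Gamma1 (p ^ n))).range.index ≠ 1 := by
    refine MixedModularSymbols.index_ne_one _ hT1 fun x => ?_
    obtain ⟨g, rfl⟩ := MixedModularSymbols.exists_coset_eq _ x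
    rw [Ne, MixedModularSymbols.cosetMul_U_eq_iff]
    have : p ≤ p ^ n := Nat.le_self_pow (by omega) p
    exact MixedModularSymbols.conj_U_notMem_Gamma1 (by omega) g
  have h0 : (MixedModularSymbols.maninMap (CongruenceSubgroup.Gamma0 (p ^ n))).range.index = 1 ↔
      p ≡ 1 [MOD 3] := by
    constructor
    · intro h
      by_contra hp3
      refine MixedModularSymbols.index_ne_one _ hT0 (fun x => ?_) h
      obtain ⟨g, rfl⟩ := MixedModularSymbols.exists_coset_eq _ x
      rw [Ne, MixedModularSymbols.cosetMul_U_eq_iff]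
      exact MixedModularSymbols.conj_U_notMem_Gamma0 hp h5 hn hp3 g
    · intro hp3
      obtain ⟨x, hx⟩ := MixedModularSymbols.exists_cosetMul_U_eq hp h5 hn hp3
      exact MixedModularSymbols.index_eq_one _ hodd hle0 hx
  rcases hΓ with rfl | rfl
  · refine ⟨MixedModularSymbols.index_dvd_three _ hodd hle1, fun h => absurd h h1, ?_⟩
    -- There is no need to prove Γ₁(pⁿ) ≠ Γ₀(pⁿ): an equality would just transport the index
    -- computed for Γ₀(pⁿ).
    rintro ⟨hp3, e⟩
    rw [e]
    exact h0.mpr hp3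
  · refine ⟨MixedModularSymbols.index_dvd_three _ hodd hle0, ?_⟩
    rw [h0]
    exact ⟨fun h => ⟨h, rfl⟩, fun h => h.1⟩
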